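/- Let $(\Omega,\mathcal F,\mu)$ be a $\sigma$-finite measure space and let $\mathcal P_>$ be the set of probability densities (modulo $\mu$-a.e. equality) that are positive $\mu$-a.e. Let $\Phi=\cosh-1$ and let $\Phi_*(y)=|y|\sinh^{-1}|y|-\sqrt{1+y^2}+1$ be its conjugate. For $p\in\mathcal P_>$ write $\mathbb E_p f=\int f\,p\,d\mu$; for $\Psi\in\{\Phi,\Phi_*\}$ let $L^{\Psi}(p)$ be the set of random variables $f$ with $\mathbb E_p[\Psi(\alpha f)]<\infty$ for some $\alpha>0$. The space $L^\Phi(p)$ carries the Luxemburg norm, whose closed unit ball is $\{v:\mathbb E_p[\Phi(v)]\le 1\}$. Put $B_p=\{u\in L^\Phi(p):\mathbb E_p u=0\}$, ${}^*B_p=\{g\in L^{\Phi_*}(p):\mathbb E_p g=0\}$, $K_p(u)=\log\mathbb E_p[e^u]\in(-\infty,+\infty]$ for $u\in B_p$, $\mathcal S_p$ the interior in $B_p$ of $\{K_p<\infty\}$, $e_p(u)=e^{u-K_p(u)}\,p$ for $u\in\mathcal S_p$, and $\mathcal E(p)=e_p(\mathcal S_p)$ (the maximal exponential model at $p$). The chart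 is $s_p(q)=\log\frac qp-\mathbb E_p\big[\log\frac qp\big]$. Fix $p_0\in\mathcal P_>$, let $\mathcal E=\mathcal E(p_0)$, and let $E:\mathcal E\to\mathbb R$ be of class $C^1$, i.e. $E\circ e_{p_0}$ is continuously Fréchet differentiable on $\mathcal S_{p_0}$. For every $p\in\mathcal E$ one has $\mathcal E(p)=\mathcal E$, the maps $s_p:\mathcal E\to\mathcal S_p$ and $e_p:\mathcal S_p\to\mathcal E$ are inverse bijections, and $E_p:=E\circ e_p$ is of class $C^1$ on $\mathcal S_p$; moreover $L^\Phi(p)=L^\Phi(q)$ for $p,q\in\mathcal E$, so that ${}^e\mathbb U_q^p w:=w-\mathbb E_p w$ maps $B_q$ to $B_p$. Furthermore: 1. For each $q\in\mathcal E$ there is a continuous linear functional $\ell_q$ on $B_q$ such that for every $p\in\mathcal E$, with $u=s_p(q)$, $E_p$ is differentiable at $u$ and $$dE_p(u)\big({}^e\mathbb U_q^p w\big)=\ell_q(w),\qquad w\in B_q;$$ that is, this functional does not depend on the chart centre $p$. 2. Let $G$ be a vector field, $G(q)\in B_q$ for every $q$. Then $E_q$ is differentiable at $0$, and the covariant derivative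 $D_GE(q):=dE_q(0)\,G(q)$ satisfies, for all $p,q\in\mathcal E$, $$D_GE(q)=dE_p(s_p(q))\big({}^e\mathbb U_q^p G(q)\big).$$ 3. Let $p,q\in\mathcal E$, $u=s_p(q)$, and suppose that $dE_p(u)$ is represented by some $\nabla E_p(u)\in{}^*B_p$, i.e. $dE_p(u)v=\mathbb E_p[\nabla E_p(u)\,v]$ for all $v\in B_p$. Then for every vector field $G$ the product $\frac pq\nabla E_p(u)\,G(q)$ is integrable with respect to $q\,\mu$ and $$D_GE(q)=\mathbb E_q\Big[\tfrac pq\,\nabla E_p(u)\,G(q)\Big].$$ Moreover $\frac pq\nabla E_p(u)$ belongs to ${}^*B_q$, and it is the only $h\in{}^*B_q$ such that $D_GE(q)=\mathbb E_q[h\,G(q)]$ for all vector fields $G$. It is called the covariant gradient of $E$ at $q$. -/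

import Mathlib

open MeasureTheory Set
open scoped ENNReal Topology

noncomputable section

namespace ExpModel

variable {Ω : Type*} [MeasurableSpace Ω] {μ : Measure Ω}

/-- Strictly positive probability densities with respect to `μ`, as classes of functions modulo
`μ`-almost everywhere equality. -/
structure PosDensity (μ : Measure Ω) where
  dens : Ω →ₘ[μ] ℝ
  pos : ∀ᵐ x ∂μ, 0 < dens x
  lintegral_eq_one : ∫⁻ x, ENNReal.ofReal (dens x) ∂μ = 1

/-- The probability measure `p · μ`. -/
def PosDensity.prob (p : PosDensity μ) : Measure Ω :=
  μ.withDensity fun x => ENNReal.ofReal (p.dens x)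

/-- The expectation `E_p f`. -/
def expect (p : PosDensity μ) (f : Ω →ₘ[μ] ℝ) : ℝ := ∫ x, f x ∂p.prob

/-- The Young function `Φ = cosh - 1`. -/
def Phi (x : ℝ) : ℝ := Real.cosh x - 1

/-- The Young function conjugate to `Φ = cosh - 1`. -/
def PhiStar (y : ℝ) : ℝ := |y| * Real.arsinh |y| - √(1 + y ^ 2) + 1

/-- The modular `E_p [Ψ(f)]` of a nonnegative function `Ψ`. -/
def modular (Ψ : ℝ → ℝ) (p : PosDensity μ) (f : Ω →ₘ[μ] ℝ) : ℝ≥0∞ :=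
  ∫⁻ x, ENNReal.ofReal (Ψ (f x)) ∂p.prob

/-- Membership in the Orlicz class of `Ψ`: `E_p [Ψ(α f)] < ∞` for some `α > 0`. -/
def MemOrlicz (Ψ : ℝ → ℝ) (p : PosDensity μ) (f : Ω →ₘ[μ] ℝ) : Prop :=
  ∃ α : ℝ, 0 < α ∧ modular Ψ p (α • f) < ∞

/-! ### Facts needed to make `L^Φ(p)` a normed space -/

theorem Phi_nonneg (x : ℝ) : 0 ≤ Phi x := sub_nonneg.2 (Real.one_le_cosh x)

theorem Phi_le_of_abs_le {x y : ℝ} (h : |x| ≤ |y|) : Phi x ≤ Phi y :=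
  sub_le_sub_right (Real.cosh_le_cosh.2 h) 1

theorem Phi_convex {x y a b : ℝ} (ha : 0 ≤ a) (hb : 0 ≤ b) (hab : a + b = 1) :
    Phi (a * x + b * y) ≤ a * Phi x + b * Phi y := by
  have h1 := convexOn_exp.2 (mem_univ x) (mem_univ y) ha hb hab
  have h2 := convexOn_exp.2 (mem_univ (-x)) (mem_univ (-y)) ha hb hab
  simp only [smul_eq_mul] at h1 h2
  have h3 : -(a * x + b * y) = a * -x + b * -y := by ring
  simp only [Phi, Real.cosh_eq, h3]
  have : a * ((Real.exp x + Real.exp (-x)) / 2 - 1) + b * ((Real.exp y + Real.exp (-y)) / 2 - 1)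
      = (a * Real.exp x + b * Real.exp y + (a * Real.exp (-x) + b * Real.exp (-y))) / 2
        - (a + b) := by ring
  rw [this, hab]
  linarith

theorem abs_le_one_add_Phi (x : ℝ) : |x| ≤ 1 + Phi x := by
  have h := Real.self_le_sinh_iff.2 (abs_nonneg x)
  have h2 := Real.sinh_lt_cosh |x|
  rw [Real.cosh_abs] at h2
  simp only [Phi]
  linarith

theorem measurable_Phi : Measurable Phi := Real.measurable_cosh.sub_const 1

theorem prob_ac (p : PosDensity μ) : p.prob ≪ μ := withDensity_absolutelyContinuous _ _

theorem ac_prob (p : PosDensity μ) : μ ≪ p.prob := by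
  refine withDensity_absolutelyContinuous'
    (p.dens.measurable.ennreal_ofReal).aemeasurable ?_
  filter_upwards [p.pos] with x hx
  exact (ENNReal.ofReal_pos.2 hx).ne'

instance instProb (p : PosDensity μ) : IsProbabilityMeasure p.prob :=
  ⟨by rw [PosDensity.prob, withDensity_apply _ MeasurableSet.univ, setLIntegral_univ,
    p.lintegral_eq_one]⟩

theorem modular_mono_of_le {p : PosDensity μ} {f g : Ω →ₘ[μ] ℝ}
    (h : ∀ᵐ x ∂μ, |f x| ≤ |g x|) : modular Phi p f ≤ modular Phi p g := by
  refine lintegral_mono_ae ?_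
  filter_upwards [(prob_ac p).ae_le h] with x hx
  exact ENNReal.ofReal_le_ofReal (Phi_le_of_abs_le hx)

theorem modular_smul_le {p : PosDensity μ} {f : Ω →ₘ[μ] ℝ} {c : ℝ} (hc : |c| ≤ 1) :
    modular Phi p (c • f) ≤ modular Phi p f := by
  refine modular_mono_of_le ?_
  filter_upwards [AEEqFun.coeFn_smul c f] with x hx
  rw [hx, Pi.smul_apply, smul_eq_mul, abs_mul]
  exact mul_le_of_le_one_left (abs_nonneg _) hc

theorem modular_zero (p : PosDensity μ) : modular Phi p 0 = 0 := by
  have h : ∀ᵐ x ∂p.prob, ENNReal.ofReal (Phi ((0 : Ω →ₘ[μ] ℝ) x)) = 0 := by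
    filter_upwards [(prob_ac p).ae_le (AEEqFun.coeFn_zero (μ := μ) (β := ℝ))] with x hx
    rw [hx]
    simp [Phi]
  rw [modular, lintegral_congr_ae h, lintegral_zero]

theorem modular_convex {p : PosDensity μ} {f g : Ω →ₘ[μ] ℝ} {a b : ℝ} (ha : 0 ≤ a) (hb : 0 ≤ b)
    (hab : a + b = 1) :
    modular Phi p (a • f + b • g)
      ≤ ENNReal.ofReal a * modular Phi p f + ENNReal.ofReal b * modular Phi p g := by
  have mf : Measurable fun x => ENNReal.ofReal (Phi (f x)) :=
    (measurable_Phi.comp f.measurable).ennreal_ofReal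
  have mg : Measurable fun x => ENNReal.ofReal (Phi (g x)) :=
    (measurable_Phi.comp g.measurable).ennreal_ofReal
  rw [modular, modular, modular, ← lintegral_const_mul _ mf, ← lintegral_const_mul _ mg,
    ← lintegral_add_left (mf.const_mul _)]
  refine lintegral_mono_ae ?_
  filter_upwards [(prob_ac p).ae_le (AEEqFun.coeFn_add (a • f) (b • g)),
    (prob_ac p).ae_le (AEEqFun.coeFn_smul a f), (prob_ac p).ae_le (AEEqFun.coeFn_smul b g)]
    with x h1 h2 h3
  rw [h1, Pi.add_apply, h2, h3, Pi.smul_apply, Pi.smul_apply, smul_eq_mul, smul_eq_mul,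
    ← ENNReal.ofReal_mul ha, ← ENNReal.ofReal_mul hb,
    ← ENNReal.ofReal_add (mul_nonneg ha (Phi_nonneg _)) (mul_nonneg hb (Phi_nonneg _))]
  exact ENNReal.ofReal_le_ofReal (Phi_convex ha hb hab)

/-- The exponential Orlicz space `L^Φ(p)` as a linear subspace of the space of random variables
modulo `μ`-almost everywhere equality. -/
def LPhi (p : PosDensity μ) : Submodule ℝ (Ω →ₘ[μ] ℝ) where
  carrier := {f | MemOrlicz Phi p f}
  zero_mem' := ⟨1, one_pos, by rw [smul_zero, modular_zero]; exact ENNReal.zero_lt_top⟩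
  add_mem' := by
    rintro f g ⟨a, ha, hf⟩ ⟨b, hb, hg⟩
    set c := min a b with hc
    have hc0 : 0 < c := lt_min ha hb
    have key : ∀ {d : ℝ} {h : Ω →ₘ[μ] ℝ}, 0 < d → c ≤ d → modular Phi p (d • h) < ∞ →
        modular Phi p (c • h) < ∞ := by
      intro d h hd hcd hh
      have : c • h = (c / d) • (d • h) := by rw [smul_smul, div_mul_cancel₀ _ hd.ne']
      rw [this]
      refine (modular_smul_le ?_).trans_lt hh
      rw [abs_of_pos (div_pos hc0 hd)]
      exact (div_le_one hd).2 hcd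
    refine ⟨c / 2, by positivity, ?_⟩
    have : (c / 2) • (f + g) = (1 / 2 : ℝ) • (c • f) + (1 / 2 : ℝ) • (c • g) := by
      rw [smul_smul, smul_smul, smul_add]
      congr 2 <;> ring
    rw [this]
    refine (modular_convex (by norm_num) (by norm_num) (by norm_num)).trans_lt ?_
    exact ENNReal.add_lt_top.2
      ⟨ENNReal.mul_lt_top ENNReal.ofReal_lt_top (key ha (min_le_left _ _) hf),
        ENNReal.mul_lt_top ENNReal.ofReal_lt_top (key hb (min_le_right _ _) hg)⟩
  smul_mem' := by
    rintro c f ⟨a, ha, hf⟩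
    have hd : 0 < |c| + 1 := by positivity
    refine ⟨a / (|c| + 1), by positivity, ?_⟩
    have : (a / (|c| + 1)) • (c • f) = (c / (|c| + 1)) • (a • f) := by
      rw [smul_smul, smul_smul]
      congr 1
      ring
    rw [this]
    refine (modular_smul_le ?_).trans_lt hf
    rw [abs_div, abs_of_pos hd, div_le_one hd]
    linarith

/-- `L^Φ(p)` as a type, which carries the Luxemburg norm. -/
def LPhiSpace (p : PosDensity μ) : Type _ := LPhi p

instance instAddCommGroupLPhi (p : PosDensity μ) : AddCommGroup (LPhiSpace p) :=
  inferInstanceAs (AddCommGroup (LPhi p))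

instance instModuleLPhi (p : PosDensity μ) : Module ℝ (LPhiSpace p) :=
  inferInstanceAs (Module ℝ (LPhi p))

/-- The inclusion of `L^Φ(p)` in the space of random variables. -/
def incl (p : PosDensity μ) : LPhiSpace p →ₗ[ℝ] (Ω →ₘ[μ] ℝ) := (LPhi p).subtype

theorem incl_injective (p : PosDensity μ) : Function.Injective (incl p) :=
  (LPhi p).injective_subtype

theorem incl_mem {p : PosDensity μ} (v : LPhiSpace p) : incl p v ∈ LPhi p := v.2

/-- The closed unit ball `{v | E_p [Φ(v)] ≤ 1}` of the Luxemburg norm. -/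
def unitBall (p : PosDensity μ) : Set (LPhiSpace p) := {v | modular Phi p (incl p v) ≤ 1}

theorem unitBall_balanced (p : PosDensity μ) : Balanced ℝ (unitBall p) := by
  intro c hc
  rintro _ ⟨v, hv, rfl⟩
  change modular Phi p (incl p (c • v)) ≤ 1
  rw [map_smul]
  exact (modular_smul_le (by simpa using hc)).trans hv

theorem unitBall_convex (p : PosDensity μ) : Convex ℝ (unitBall p) := by
  intro v hv w hw a b ha hb hab
  change modular Phi p (incl p (a • v + b • w)) ≤ 1
  rw [map_add, map_smul, map_smul]
  refine (modular_convex ha hb hab).trans ?_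
  calc _ ≤ ENNReal.ofReal a * 1 + ENNReal.ofReal b * 1 := by
        gcongr
        · exact hv
        · exact hw
    _ = 1 := by rw [mul_one, mul_one, ← ENNReal.ofReal_add ha hb, hab, ENNReal.ofReal_one]

theorem unitBall_absorbent (p : PosDensity μ) : Absorbent ℝ (unitBall p) := by
  rw [absorbent_iff_eventually_nhdsNE_zero]
  intro v
  obtain ⟨a, ha, hf⟩ := incl_mem v
  set f : Ω →ₘ[μ] ℝ := incl p v
  obtain ⟨r, hr0, hr1, hr⟩ : ∃ r : ℝ, 0 < r ∧ r ≤ 1 ∧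
      ENNReal.ofReal r * modular Phi p (a • f) ≤ 1 := by
    set M := (modular Phi p (a • f)).toReal with hM
    have hM0 : 0 ≤ M := ENNReal.toReal_nonneg
    refine ⟨1 / (M + 1), by positivity, ?_, ?_⟩
    · rw [div_le_one (by positivity)]; linarith
    · rw [← ENNReal.ofReal_toReal hf.ne, ← hM, ← ENNReal.ofReal_mul (by positivity),
        ← ENNReal.ofReal_one]
      refine ENNReal.ofReal_le_ofReal ?_
      rw [one_div, inv_mul_le_iff₀ (by positivity)]
      linarith
  have hmem : modular Phi p ((r * a) • f) ≤ 1 := by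
    have h := modular_convex (p := p) (f := a • f) (g := 0) hr0.le (sub_nonneg.2 hr1)
      (add_sub_cancel r 1)
    rw [smul_zero, add_zero, modular_zero, mul_zero, add_zero, smul_smul] at h
    exact h.trans hr
  have hra : 0 < r * a := mul_pos hr0 ha
  refine Filter.Eventually.filter_mono nhdsWithin_le_nhds ?_
  filter_upwards [Metric.ball_mem_nhds (0 : ℝ) hra] with c hc
  have hc' : |c| ≤ r * a := by simpa using (Metric.mem_ball.1 hc).le
  change modular Phi p (incl p (c • v)) ≤ 1
  rw [map_smul]
  change modular Phi p (c • f) ≤ 1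
  have : c • f = (c / (r * a)) • ((r * a) • f) := by rw [smul_smul, div_mul_cancel₀ _ hra.ne']
  rw [this]
  refine (modular_smul_le ?_).trans hmem
  rw [abs_div, abs_of_pos hra]
  exact (div_le_one hra).2 hc'

theorem eq_zero_of_gauge_eq_zero {p : PosDensity μ} {v : LPhiSpace p}
    (hv : gauge (unitBall p) v = 0) : v = 0 := by
  set f : Ω →ₘ[μ] ℝ := incl p v with hf
  have h1 : ∀ n : ℕ, modular Phi p ((n + 1 : ℝ) • f) ≤ 1 := by
    intro n
    have hn : (0 : ℝ) < (n + 1 : ℝ) := by positivity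
    obtain ⟨r, hr0, hr1, w, hw, hwv⟩ :=
      exists_lt_of_gauge_lt (unitBall_absorbent p) (hv.trans_lt (inv_pos.2 hn))
    have e : (n + 1 : ℝ) • f = ((n + 1 : ℝ) * r) • incl p w := by
      rw [hf, ← hwv, mul_smul, map_smul]
    rw [e]
    refine (modular_smul_le ?_).trans hw
    rw [abs_of_pos (mul_pos hn hr0)]
    calc (n + 1 : ℝ) * r ≤ (n + 1 : ℝ) * ((n + 1 : ℝ))⁻¹ := by gcongr
      _ = 1 := mul_inv_cancel₀ hn.ne'
  have h2 : ∀ n : ℕ, ((n + 1 : ℕ) : ℝ≥0∞) * modular Phi p f ≤ 1 := by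
    intro n
    have hn : (0 : ℝ) < (n + 1 : ℝ) := by positivity
    have h := modular_convex (p := p) (f := (n + 1 : ℝ) • f) (g := 0)
      (a := ((n + 1 : ℝ))⁻¹) (b := 1 - ((n + 1 : ℝ))⁻¹) (by positivity)
      (sub_nonneg.2 (inv_le_one_of_one_le₀ (by linarith [(Nat.cast_nonneg n : (0 : ℝ) ≤ n)])))
      (by ring)
    rw [smul_zero, add_zero, modular_zero, mul_zero, add_zero, smul_smul,
      inv_mul_cancel₀ hn.ne', one_smul] at h
    calc ((n + 1 : ℕ) : ℝ≥0∞) * modular Phi p f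
        ≤ ((n + 1 : ℕ) : ℝ≥0∞) * (ENNReal.ofReal ((n + 1 : ℝ))⁻¹ * 1) := by
          gcongr
          exact h.trans (mul_le_mul_right (h1 n) _)
      _ = ENNReal.ofReal ((n + 1 : ℝ) * ((n + 1 : ℝ))⁻¹) := by
          rw [mul_one, ENNReal.ofReal_mul hn.le]
          congr 1
          rw [← ENNReal.ofReal_natCast]
          push_cast
          rfl
      _ = 1 := by rw [mul_inv_cancel₀ hn.ne', ENNReal.ofReal_one]
  have h3 : modular Phi p f = 0 := by
    by_contra h0
    obtain ⟨n, hn⟩ := ENNReal.exists_nat_mul_gt h0 (ENNReal.one_ne_top)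
    refine absurd (h2 n) (not_le.2 (hn.trans_le ?_))
    gcongr
    exact Nat.le_succ n
  have h4 : ∀ᵐ x ∂p.prob, ENNReal.ofReal (Phi (f x)) = 0 :=
    (lintegral_eq_zero_iff (measurable_Phi.comp f.measurable).ennreal_ofReal).1 h3
  have h5 : f =ᵐ[μ] (0 : Ω →ₘ[μ] ℝ) := by
    filter_upwards [(ac_prob p).ae_le h4, AEEqFun.coeFn_zero (μ := μ) (β := ℝ)] with x hx h0
    rw [h0]
    have hx' : Phi (f x) ≤ 0 := ENNReal.ofReal_eq_zero.1 hx
    by_contra hne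
    have : 1 < Real.cosh (f x) := Real.one_lt_cosh.2 hne
    simp only [Phi] at hx'
    linarith
  exact incl_injective p ((AEEqFun.ext h5).trans (map_zero (incl p)).symm)

/-- The Luxemburg norm on `L^Φ(p)`: the gauge of the set `{v | E_p [Φ(v)] ≤ 1}`. -/
instance instNormedAddCommGroupLPhi (p : PosDensity μ) : NormedAddCommGroup (LPhiSpace p) :=
  AddGroupNorm.toNormedAddCommGroup
    { (gaugeSeminorm (𝕜 := ℝ) (unitBall_balanced p) (unitBall_convex p)
        (unitBall_absorbent p)).toAddGroupSeminorm with
      eq_zero_of_map_eq_zero' := fun _ h => eq_zero_of_gauge_eq_zero h }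

theorem norm_def (p : PosDensity μ) (v : LPhiSpace p) : ‖v‖ = gauge (unitBall p) v := rfl

instance instNormedSpaceLPhi (p : PosDensity μ) : NormedSpace ℝ (LPhiSpace p) where
  norm_smul_le c v :=
    (map_smul_eq_mul (gaugeSeminorm (𝕜 := ℝ) (unitBall_balanced p) (unitBall_convex p)
      (unitBall_absorbent p)) c v).le

theorem integrable_of_mem {p : PosDensity μ} {f : Ω →ₘ[μ] ℝ} (hf : f ∈ LPhi p) :
    Integrable (fun x => f x) p.prob := by
  obtain ⟨a, ha, h⟩ := hf
  have hm : AEStronglyMeasurable (fun x => f x) p.prob := f.measurable.aestronglyMeasurable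
  have hP : Integrable (fun x => Phi ((a • f : Ω →ₘ[μ] ℝ) x)) p.prob := by
    refine ⟨(measurable_Phi.comp (a • f).measurable).aestronglyMeasurable, ?_⟩
    rw [hasFiniteIntegral_iff_ofReal (Filter.Eventually.of_forall fun x => Phi_nonneg _)]
    exact h
  refine (((integrable_const (1 : ℝ)).add hP).const_mul a⁻¹).mono' hm ?_
  filter_upwards [(prob_ac p).ae_le (AEEqFun.coeFn_smul a f)] with x hx
  have h1 := abs_le_one_add_Phi ((a • f : Ω →ₘ[μ] ℝ) x)
  have h2 : |(a • f : Ω →ₘ[μ] ℝ) x| = a * |f x| := by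
    rw [hx, Pi.smul_apply, smul_eq_mul, abs_mul, abs_of_pos ha]
  rw [h2] at h1
  simp only [Pi.add_apply, Real.norm_eq_abs]
  rw [le_inv_mul_iff₀ ha]
  exact h1

theorem const_mem (p : PosDensity μ) (c : ℝ) : (AEEqFun.const Ω c : Ω →ₘ[μ] ℝ) ∈ LPhi p := by
  refine ⟨1, one_pos, ?_⟩
  have h : ∀ᵐ x ∂p.prob,
      ENNReal.ofReal (Phi (((1 : ℝ) • (AEEqFun.const Ω c : Ω →ₘ[μ] ℝ) : Ω →ₘ[μ] ℝ) x))
        = ENNReal.ofReal (Phi c) := by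
    rw [one_smul]
    filter_upwards [(prob_ac p).ae_le (AEEqFun.coeFn_const (μ := μ) Ω c)] with x hx
    rw [hx, Function.const_apply]
  rw [modular, lintegral_congr_ae h, lintegral_const, measure_univ, mul_one]
  exact ENNReal.ofReal_lt_top

theorem expect_add {p : PosDensity μ} {f g : Ω →ₘ[μ] ℝ} (hf : f ∈ LPhi p) (hg : g ∈ LPhi p) :
    expect p (f + g) = expect p f + expect p g := by
  rw [expect, integral_congr_ae ((prob_ac p).ae_le (AEEqFun.coeFn_add f g))]
  exact integral_add (integrable_of_mem hf) (integrable_of_mem hg)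

theorem expect_smul (p : PosDensity μ) (c : ℝ) (f : Ω →ₘ[μ] ℝ) :
    expect p (c • f) = c * expect p f := by
  rw [expect, integral_congr_ae ((prob_ac p).ae_le (AEEqFun.coeFn_smul c f))]
  exact integral_const_mul c _

theorem expect_const (p : PosDensity μ) (c : ℝ) :
    expect p (AEEqFun.const Ω c : Ω →ₘ[μ] ℝ) = c := by
  rw [expect, integral_congr_ae ((prob_ac p).ae_le (AEEqFun.coeFn_const (μ := μ) Ω c))]
  simp

/-! ### Model spaces, charts and transports -/

/-- The model space `B_p = L^Φ_0(p)` of centred elements of `L^Φ(p)`, with the Luxemburg norm. -/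
def B (p : PosDensity μ) : Submodule ℝ (LPhiSpace p) where
  carrier := {u | expect p (incl p u) = 0}
  zero_mem' := by
    have h := expect_smul p 0 (0 : Ω →ₘ[μ] ℝ)
    rw [zero_smul, zero_mul] at h
    rw [mem_ofPred_eq, map_zero]
    exact h
  add_mem' := by
    intro u v hu hv
    rw [mem_ofPred_eq] at hu hv ⊢
    rw [map_add, expect_add (incl_mem u) (incl_mem v), hu, hv, add_zero]
  smul_mem' := by
    intro c u hu
    rw [mem_ofPred_eq] at hu ⊢
    rw [map_smul, expect_smul, hu, mul_zero]

/-- The random variable underlying an element of `B_p`. -/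
def rv {p : PosDensity μ} (u : B p) : Ω →ₘ[μ] ℝ := incl p u

/-- The space `L^{Φ_*}_0(p)` of centred elements of `L^{Φ_*}(p)`, fibre of the pretangent
bundle. -/
def preB (p : PosDensity μ) : Set (Ω →ₘ[μ] ℝ) := {g | MemOrlicz PhiStar p g ∧ expect p g = 0}

theorem centre_mem {p : PosDensity μ} {f : Ω →ₘ[μ] ℝ} (hf : f ∈ LPhi p) :
    f - AEEqFun.const Ω (expect p f) ∈ LPhi p := (LPhi p).sub_mem hf (const_mem p _)

theorem expect_centre {p : PosDensity μ} {f : Ω →ₘ[μ] ℝ} (hf : f ∈ LPhi p) :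
    expect p (f - AEEqFun.const Ω (expect p f)) = 0 := by
  have h : f - AEEqFun.const Ω (expect p f)
      = f + (-1 : ℝ) • (AEEqFun.const Ω (expect p f) : Ω →ₘ[μ] ℝ) := by
    rw [neg_one_smul, sub_eq_add_neg]
  rw [h, expect_add hf ((LPhi p).smul_mem _ (const_mem p _)), expect_smul, expect_const]
  ring

open Classical in
/-- `f - E_p f` as an element of `B_p`, for `f ∈ L^Φ(p)` (and `0` for other `f`). -/
def centre (p : PosDensity μ) (f : Ω →ₘ[μ] ℝ) : B p :=
  if hf : f ∈ LPhi p then ⟨⟨f - AEEqFun.const Ω (expect p f), centre_mem hf⟩, expect_centre hf⟩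
  else 0

/-- The moment generating functional `M_p(u) = E_p [e^u]`. -/
def M (p : PosDensity μ) (u : B p) : ℝ≥0∞ := ∫⁻ x, ENNReal.ofReal (Real.exp (rv u x)) ∂p.prob

/-- The cumulant generating functional `K_p = log M_p` on `B_p`. -/
def K (p : PosDensity μ) (u : B p) : EReal := ENNReal.log (M p u)

/-- `S_p`: the interior in `B_p` of the proper domain of `K_p`. -/
def S (p : PosDensity μ) : Set (B p) := interior {u | K p u < ⊤}

theorem M_ne_zero (p : PosDensity μ) (u : B p) : M p u ≠ 0 := by
  intro h
  have h1 := (lintegral_eq_zero_iff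
    (Real.measurable_exp.comp (rv u).measurable).ennreal_ofReal).1 h
  have h2 : ∀ᵐ _ ∂p.prob, False := by
    filter_upwards [h1] with x hx
    exact (Real.exp_pos _).not_ge (ENNReal.ofReal_eq_zero.1 hx)
  have h3 : p.prob = 0 := by simpa using h2
  exact IsProbabilityMeasure.ne_zero p.prob h3

theorem exp_K_toReal {p : PosDensity μ} {u : B p} (h : K p u < ⊤) :
    Real.exp (K p u).toReal = (M p u).toReal := by
  have ht : M p u ≠ ∞ := (ENNReal.log_lt_top_iff.1 h).ne
  rw [K, ENNReal.log_pos_real (M_ne_zero p u) ht, EReal.toReal_coe,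
    Real.exp_log (ENNReal.toReal_pos (M_ne_zero p u) ht)]

/-- The function `e^{u - K_p(u)} · p`. -/
def gibbs (p : PosDensity μ) (u : B p) : Ω →ₘ[μ] ℝ :=
  AEEqFun.mk (fun x => Real.exp (rv u x - (K p u).toReal) * p.dens x)
    (((Real.measurable_exp.comp ((rv u).measurable.sub_const _)).mul
      p.dens.measurable).aestronglyMeasurable)

theorem gibbs_ae (p : PosDensity μ) (u : B p) :
    gibbs p u =ᵐ[μ] fun x => Real.exp (rv u x - (K p u).toReal) * p.dens x :=
  AEEqFun.coeFn_mk _ _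

theorem gibbs_pos (p : PosDensity μ) (u : B p) : ∀ᵐ x ∂μ, 0 < gibbs p u x := by
  filter_upwards [gibbs_ae p u, p.pos] with x hx hp
  rw [hx]
  exact mul_pos (Real.exp_pos _) hp

theorem lintegral_gibbs {p : PosDensity μ} {u : B p} (h : K p u < ⊤) :
    ∫⁻ x, ENNReal.ofReal (gibbs p u x) ∂μ = 1 := by
  have ht : M p u ≠ ∞ := (ENNReal.log_lt_top_iff.1 h).ne
  have mE : Measurable fun x => ENNReal.ofReal (Real.exp (rv u x)) :=
    (Real.measurable_exp.comp (rv u).measurable).ennreal_ofReal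
  have mp : Measurable fun x => ENNReal.ofReal (p.dens x) := p.dens.measurable.ennreal_ofReal
  have h1 : ∀ᵐ x ∂μ, ENNReal.ofReal (gibbs p u x) = ENNReal.ofReal (M p u).toReal⁻¹ *
      (ENNReal.ofReal (p.dens x) * ENNReal.ofReal (Real.exp (rv u x))) := by
    filter_upwards [gibbs_ae p u, p.pos] with x hx hp
    rw [hx, Real.exp_sub, exp_K_toReal h, ← ENNReal.ofReal_mul hp.le,
      ← ENNReal.ofReal_mul (by positivity)]
    congr 1
    ring
  have h2 : ∫⁻ x, ENNReal.ofReal (p.dens x) * ENNReal.ofReal (Real.exp (rv u x)) ∂μ = M p u :=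
    (lintegral_withDensity_eq_lintegral_mul μ mp mE).symm
  have h3 : ∫⁻ x, ENNReal.ofReal (M p u).toReal⁻¹ *
      (ENNReal.ofReal (p.dens x) * ENNReal.ofReal (Real.exp (rv u x))) ∂μ
      = ENNReal.ofReal (M p u).toReal⁻¹ * M p u := by
    rw [← h2]
    exact lintegral_const_mul _ (mp.mul mE)
  rw [lintegral_congr_ae h1, h3,
    ENNReal.ofReal_inv_of_pos (ENNReal.toReal_pos (M_ne_zero p u) ht), ENNReal.ofReal_toReal ht,
    ENNReal.inv_mul_cancel (M_ne_zero p u) ht]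

open Classical in
/-- The inverse chart `e_p(u) = e^{u - K_p(u)} · p` where `K_p(u) < ∞`, in particular on `S_p`
(and `p` elsewhere). -/
def chartInv (p : PosDensity μ) (u : B p) : PosDensity μ :=
  if h : K p u < ⊤ then ⟨gibbs p u, gibbs_pos p u, lintegral_gibbs h⟩ else p

/-- The maximal exponential model at `p`. -/
def maxExp (p : PosDensity μ) : Set (PosDensity μ) := chartInv p '' S p

/-- `log (q / p)`. -/
def logRatio (q p : PosDensity μ) : Ω →ₘ[μ] ℝ :=
  AEEqFun.mk (fun x => Real.log (q.dens x / p.dens x))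
    (Real.measurable_log.comp (q.dens.measurable.div p.dens.measurable)).aestronglyMeasurable

/-- The chart `s_p(q) = log (q / p) - E_p [log (q / p)]`. -/
def chart (p q : PosDensity μ) : B p := centre p (logRatio q p)

/-- The exponential transport `B_q → B_p`, `w ↦ w - E_p w`. -/
def eTransport (q p : PosDensity μ) (w : B q) : B p := centre p (rv w)

/-- The mixture transport `g ↦ (p / q) g`. -/
def mTransport (p q : PosDensity μ) (g : Ω →ₘ[μ] ℝ) : Ω →ₘ[μ] ℝ :=
  AEEqFun.mk (fun x => p.dens x / q.dens x * g x)
    ((p.dens.measurable.div q.dens.measurable).mul g.measurable).aestronglyMeasurable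

/-! ### Real functions on the exponential manifold -/

/-- The representation `E_p = E ∘ e_p` of `E` in the chart centred at `p`. -/
def rep (E : PosDensity μ → ℝ) (p : PosDensity μ) : B p → ℝ := fun u => E (chartInv p u)

/-- `E` is of class `C¹` on `maxExp p` (only the values there matter): `E_p` is continuously
Fréchet differentiable on `S_p`. The chart `s_p` covers all of `maxExp p`. -/
def IsC1On (E : PosDensity μ → ℝ) (p : PosDensity μ) : Prop := ContDiffOn ℝ 1 (rep E p) (S p)

/-- The covariant derivative `D_G E (q) = dE_q(0) G(q)` along a vector field `G` of the tangent
bundle, whose fibre at `q` is `B_q`. -/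
def covDeriv (E : PosDensity μ → ℝ) (G : (q : PosDensity μ) → B q) (q : PosDensity μ) : ℝ :=
  fderiv ℝ (rep E q) 0 (G q)

/-- `h` is a covariant gradient of `E` at `q`: it lies in `L^{Φ_*}_0(q)` and
`D_G E (q) = E_q [h G(q)]` for every vector field `G`. -/
def IsCovGradient (E : PosDensity μ → ℝ) (q : PosDensity μ) (h : Ω →ₘ[μ] ℝ) : Prop :=
  h ∈ preB q ∧ ∀ G : (r : PosDensity μ) → B r, covDeriv E G q = expect q (h * rv (G q))

end ExpModel

end

open ExpModel

/-!
The proof rests on a comparison of Orlicz spaces under a change of density. If `u` lies in the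
interior `S p` of the domain of `K p` and `q = e^{u - K_p(u)} p`, then `(1 + r) u` has a finite
exponential moment for some `r > 0`, so `E_q [(q / p)^r] < ∞`; conversely `E_p [(p / q)^r] < ∞`
because `u ∈ L^Φ(p)`. Either moment condition (`FiniteMoment`) bounds the modular of one density by
that of the other through the convexity of `exp` (`modular_le_of_finiteMoment`). Hence
`L^Φ(p) = L^Φ(q)` and the exponential transports are mutually inverse continuous linear maps;
neither completeness nor the closed graph theorem is needed.

The transition map from the chart at `q` to the chart at `p` is therefore the affine homeomorphism
`v ↦ s_p(q) + (v - E_p v)` of `B q` onto `B p`. It matches the domains of the cumulant functionals,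
so it carries `S q` onto `S p` (`transition_preimage_S`), and `e_q(v) = e_p(s_p(q) + (v - E_p v))`
there (`chartInv_transition`). This gives the independence of the model from its centre, and by the
chain rule the independence of the differential from the chart (`fderiv_rep_eTransport`).

For the gradient, `E_q [(p / q) g w] = E_p [g (w - E_p w)]` when `E_p g = 0`
(`expect_mTransport_mul`), all integrals being absolutely convergent by the Fenchel–Young
inequality. That `(p / q) g` lies in `L^{Φ_*}(q)` follows from the growth estimate
`Φ_*(e^t y) ≤ e^t (|t| |y| + |y| + Φ_*(y))` with `t = log (p / q) ∈ L^Φ(p)`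
(`memOrlicz_mTransport`). Uniqueness is obtained by testing against the centred sign of the
difference of two candidates (`eq_of_expect_mul_eq`).
-/

noncomputable section

namespace ExpModel

variable {Ω : Type*} [MeasurableSpace Ω] {μ : Measure Ω}

/-! ### Inequalities for the conjugate pair of Young functions -/

/-- The Fenchel–Young inequality for `cosh - 1`: the tangent line of `cosh` at `arsinh |y|` lies
below its graph. -/
theorem abs_mul_le_Phi_add_PhiStar (x y : ℝ) : |x * y| ≤ Phi x + PhiStar y := by
  set s := Real.arsinh |y| with hs
  have h1 : Real.sinh s = |y| := Real.sinh_arsinh _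
  have h2 : Real.cosh s = √(1 + y ^ 2) := by rw [hs, Real.cosh_arsinh, sq_abs]
  have h3 : Real.exp s * (1 + (|x| - s)) ≤ Real.exp |x| := by
    have h := mul_le_mul_of_nonneg_left (Real.add_one_le_exp (|x| - s)) (Real.exp_pos s).le
    rw [← Real.exp_add, add_sub_cancel] at h
    linarith
  have h4 : Real.exp (-s) * (1 - (|x| - s)) ≤ Real.exp (-|x|) := by
    have h := mul_le_mul_of_nonneg_left (Real.add_one_le_exp (-(|x| - s))) (Real.exp_pos (-s)).le
    rw [← Real.exp_add, show -s + -(|x| - s) = -|x| by ring] at h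
    linarith
  have h5 : Real.cosh s + Real.sinh s * (|x| - s) ≤ Real.cosh x := by
    rw [← Real.cosh_abs x, Real.cosh_eq, Real.cosh_eq, Real.sinh_eq]
    linarith
  rw [h1, h2] at h5
  simp only [Phi, PhiStar, abs_mul, ← hs]
  linarith

theorem PhiStar_nonneg (y : ℝ) : 0 ≤ PhiStar y := by
  simpa [Phi] using abs_mul_le_Phi_add_PhiStar 0 y

theorem measurable_PhiStar : Measurable PhiStar := by
  have h : Continuous PhiStar := by
    unfold PhiStar
    have := Real.continuous_arsinh
    fun_prop
  exact h.measurable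

theorem abs_mul_arsinh_le (y : ℝ) : |y| * Real.arsinh |y| ≤ |y| + PhiStar y := by
  have h : √(1 + y ^ 2) ≤ |y| + 1 := by
    rw [Real.sqrt_le_left (by positivity)]
    nlinarith [sq_abs y, abs_nonneg y]
  simp only [PhiStar]
  linarith

theorem arsinh_exp_mul_le (t : ℝ) {a : ℝ} (ha : 0 ≤ a) :
    Real.arsinh (Real.exp t * a) ≤ |t| + Real.arsinh a := by
  have hs : 0 ≤ Real.sinh |t| := Real.sinh_nonneg_iff.2 (abs_nonneg t)
  rw [← Real.sinh_le_sinh, Real.sinh_arsinh, Real.sinh_add, Real.sinh_arsinh, Real.cosh_arsinh]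
  have h1 : a ≤ √(1 + a ^ 2) := Real.le_sqrt_of_sq_le (by linarith)
  calc Real.exp t * a ≤ Real.exp |t| * a := by gcongr; exact le_abs_self t
    _ = Real.sinh |t| * a + Real.cosh |t| * a := by rw [← Real.cosh_add_sinh]; ring
    _ ≤ _ := by gcongr

/-- The growth of `PhiStar` under multiplication by `e^t` is only linear in `t` beyond the factor
`e^t` itself, which a change of density absorbs. -/
theorem PhiStar_exp_mul_le (t y : ℝ) :
    PhiStar (Real.exp t * y) ≤ Real.exp t * (|y| * |t| + (|y| + PhiStar y)) := by
  have h1 : |Real.exp t * y| = Real.exp t * |y| := by rw [abs_mul, Real.abs_exp]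
  have h2 : 1 ≤ √(1 + (Real.exp t * y) ^ 2) :=
    Real.one_le_sqrt.2 (by nlinarith [sq_nonneg (Real.exp t * y)])
  have h3 := arsinh_exp_mul_le t (abs_nonneg y)
  calc PhiStar (Real.exp t * y)
      ≤ Real.exp t * |y| * Real.arsinh (Real.exp t * |y|) := by
        simp only [PhiStar, h1]; linarith
    _ ≤ Real.exp t * |y| * (|t| + Real.arsinh |y|) := by gcongr
    _ = Real.exp t * (|y| * |t| + |y| * Real.arsinh |y|) := by ring
    _ ≤ _ := by gcongr; exact abs_mul_arsinh_le y

theorem exp_abs_le (x : ℝ) : Real.exp |x| ≤ 2 + 2 * Phi x := by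
  have h := Real.cosh_eq |x|
  rw [Real.cosh_abs] at h
  simp only [Phi, h]
  linarith [Real.exp_pos (-|x|)]

theorem Phi_le_exp_abs (x : ℝ) : Phi x ≤ Real.exp |x| := by
  have h := Real.cosh_eq |x|
  rw [Real.cosh_abs] at h
  simp only [Phi, h]
  have : Real.exp (-|x|) ≤ Real.exp |x| := Real.exp_le_exp.2 (by linarith [abs_nonneg x])
  linarith

/-! ### Orlicz classes and change of density -/

theorem memOrlicz_iff_integrable {Ψ : ℝ → ℝ} (hΨ : ∀ x, 0 ≤ Ψ x) (hm : Measurable Ψ)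
    {p : PosDensity μ} {f : Ω →ₘ[μ] ℝ} :
    MemOrlicz Ψ p f ↔ ∃ α : ℝ, 0 < α ∧ Integrable (fun x => Ψ (α * f x)) p.prob := by
  refine exists_congr fun α => and_congr_right fun _ => ?_
  have h : modular Ψ p (α • f) = ∫⁻ x, ENNReal.ofReal (Ψ (α * f x)) ∂p.prob := by
    refine lintegral_congr_ae ?_
    filter_upwards [(prob_ac p).ae_le (AEEqFun.coeFn_smul α f)] with x hx
    rw [hx, Pi.smul_apply, smul_eq_mul]
  rw [h, Integrable, hasFiniteIntegral_iff_ofReal (Filter.Eventually.of_forall fun x => hΨ _)]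
  exact (and_iff_right (hm.comp (f.measurable.const_mul α)).aestronglyMeasurable).symm

theorem mem_LPhi_iff_integrable {p : PosDensity μ} {f : Ω →ₘ[μ] ℝ} :
    f ∈ LPhi p ↔ ∃ α : ℝ, 0 < α ∧ Integrable (fun x => Phi (α * f x)) p.prob :=
  memOrlicz_iff_integrable Phi_nonneg measurable_Phi

theorem memOrlicz_PhiStar_iff {p : PosDensity μ} {f : Ω →ₘ[μ] ℝ} :
    MemOrlicz PhiStar p f ↔ ∃ α : ℝ, 0 < α ∧ Integrable (fun x => PhiStar (α * f x)) p.prob :=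
  memOrlicz_iff_integrable PhiStar_nonneg measurable_PhiStar

theorem mem_LPhi_iff_integrable_exp {p : PosDensity μ} {f : Ω →ₘ[μ] ℝ} :
    f ∈ LPhi p ↔ ∃ α : ℝ, 0 < α ∧ Integrable (fun x => Real.exp (α * f x)) p.prob ∧
      Integrable (fun x => Real.exp (-(α * f x))) p.prob := by
  rw [mem_LPhi_iff_integrable]
  refine exists_congr fun α => and_congr_right fun _ => ⟨fun h => ?_, fun h => ?_⟩
  · have hb : Integrable (fun x => 2 + 2 * Phi (α * f x)) p.prob :=
      (integrable_const _).add (h.const_mul 2)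
    refine ⟨hb.mono' ?_ ?_, hb.mono' ?_ ?_⟩
    · exact (Real.measurable_exp.comp (f.measurable.const_mul α)).aestronglyMeasurable
    · refine Filter.Eventually.of_forall fun x => ?_
      rw [Real.norm_eq_abs, Real.abs_exp]
      exact (Real.exp_le_exp.2 (le_abs_self _)).trans (exp_abs_le _)
    · exact (Real.measurable_exp.comp (f.measurable.const_mul α).neg).aestronglyMeasurable
    · refine Filter.Eventually.of_forall fun x => ?_
      rw [Real.norm_eq_abs, Real.abs_exp]
      exact (Real.exp_le_exp.2 (neg_le_abs _)).trans (exp_abs_le _)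
  · have e : (fun x => Phi (α * f x)) =
        fun x => (Real.exp (α * f x) + Real.exp (-(α * f x))) / 2 - 1 := by
      funext x; rw [Phi, Real.cosh_eq]
    rw [e]
    exact ((h.1.add h.2).div_const 2).sub (integrable_const 1)

/-- The duality pairing of `L^Φ(p)` with `L^{Φ_*}(p)` is given by an absolutely convergent
integral. -/
theorem integrable_mul_of_mem {p : PosDensity μ} {f g : Ω →ₘ[μ] ℝ} (hf : f ∈ LPhi p)
    (hg : MemOrlicz PhiStar p g) : Integrable (fun x => f x * g x) p.prob := by
  obtain ⟨a, ha, hf⟩ := mem_LPhi_iff_integrable.1 hf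
  obtain ⟨b, hb, hg⟩ := memOrlicz_PhiStar_iff.1 hg
  refine ((hf.add hg).const_mul (a * b)⁻¹).mono'
    (f.measurable.mul g.measurable).aestronglyMeasurable (Filter.Eventually.of_forall fun x => ?_)
  have h := abs_mul_le_Phi_add_PhiStar (a * f x) (b * g x)
  rw [show a * f x * (b * g x) = a * b * (f x * g x) by ring, abs_mul,
    abs_of_pos (mul_pos ha hb)] at h
  rw [Real.norm_eq_abs, le_inv_mul_iff₀ (mul_pos ha hb)]
  exact h

theorem integrable_of_memOrlicz_PhiStar {p : PosDensity μ} {g : Ω →ₘ[μ] ℝ}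
    (hg : MemOrlicz PhiStar p g) : Integrable (fun x => g x) p.prob := by
  refine (integrable_mul_of_mem (const_mem p 1) hg).congr ?_
  filter_upwards [(prob_ac p).ae_le (AEEqFun.coeFn_const (μ := μ) Ω (1 : ℝ))] with x hx
  rw [hx, Function.const_apply, one_mul]

theorem exp_logRatio_ae (q p : PosDensity μ) :
    ∀ᵐ x ∂μ, Real.exp (logRatio q p x) = q.dens x / p.dens x := by
  filter_upwards [AEEqFun.coeFn_mk (μ := μ) (fun x => Real.log (q.dens x / p.dens x))
    (Real.measurable_log.comp (q.dens.measurable.div p.dens.measurable)).aestronglyMeasurable,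
    p.pos, q.pos] with x hx hp hq
  rw [logRatio, hx, Real.exp_log (div_pos hq hp)]

theorem logRatio_swap_ae (q p : PosDensity μ) : ∀ᵐ x ∂μ, logRatio p q x = -logRatio q p x := by
  filter_upwards [exp_logRatio_ae q p, exp_logRatio_ae p q] with x h1 h2
  rw [← Real.exp_eq_exp, Real.exp_neg, h1, h2, inv_div]

theorem measurable_ofReal_exp_logRatio (q p : PosDensity μ) :
    Measurable fun x => ENNReal.ofReal (Real.exp (logRatio q p x)) :=
  (Real.measurable_exp.comp (logRatio q p).measurable).ennreal_ofReal

theorem prob_eq_withDensity (q p : PosDensity μ) :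
    q.prob = p.prob.withDensity fun x => ENNReal.ofReal (Real.exp (logRatio q p x)) := by
  have mL := measurable_ofReal_exp_logRatio q p
  rw [PosDensity.prob, PosDensity.prob,
    ← MeasureTheory.withDensity_mul μ p.dens.measurable.ennreal_ofReal mL]
  refine withDensity_congr_ae ?_
  filter_upwards [exp_logRatio_ae q p, p.pos, q.pos] with x hx hp hq
  rw [Pi.mul_apply, hx, ← ENNReal.ofReal_mul hp.le, mul_div_cancel₀ _ hp.ne']

theorem lintegral_prob_eq (q p : PosDensity μ) {F : Ω → ℝ≥0∞} (hF : Measurable F) :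
    ∫⁻ x, F x ∂q.prob = ∫⁻ x, ENNReal.ofReal (Real.exp (logRatio q p x)) * F x ∂p.prob := by
  rw [prob_eq_withDensity q p]
  exact lintegral_withDensity_eq_lintegral_mul _
    (measurable_ofReal_exp_logRatio q p) hF

theorem integrable_prob_iff (q p : PosDensity μ) {F : Ω → ℝ} :
    Integrable F q.prob ↔ Integrable (fun x => Real.exp (logRatio q p x) * F x) p.prob := by
  rw [prob_eq_withDensity q p, integrable_withDensity_iff_integrable_smul'
    (measurable_ofReal_exp_logRatio q p)
    (Filter.Eventually.of_forall fun _ => ENNReal.ofReal_lt_top)]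
  simp only [ENNReal.toReal_ofReal (Real.exp_pos _).le, smul_eq_mul]

theorem integral_prob_eq (q p : PosDensity μ) (F : Ω → ℝ) :
    ∫ x, F x ∂q.prob = ∫ x, Real.exp (logRatio q p x) * F x ∂p.prob := by
  rw [prob_eq_withDensity q p, integral_withDensity_eq_integral_toReal_smul
    (measurable_ofReal_exp_logRatio q p)
    (Filter.Eventually.of_forall fun _ => ENNReal.ofReal_lt_top)]
  simp only [ENNReal.toReal_ofReal (Real.exp_pos _).le, smul_eq_mul]

/-- `E_q [(q / p)^r] < ∞` for some `r > 0`; equivalently, `q / p` has a finite moment of order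
`1 + r > 1` under `p`. -/
def FiniteMoment (p q : PosDensity μ) : Prop :=
  ∃ r : ℝ, 0 < r ∧ Integrable (fun x => Real.exp (r * logRatio q p x)) q.prob

/-- A finite moment of `q / p` of order greater than one under `p` controls the modular of `q` by
that of `p`. The exponent `r / (1 + r)` makes `t + r / (1 + r) * |f|` a convex combination of
`(1 + r) * t` and `|f|`. -/
theorem modular_le_of_finiteMoment {p q : PosDensity μ} (h : FiniteMoment p q) :
    ∃ β : ℝ, 0 < β ∧ ∃ C : ℝ, 0 ≤ C ∧ ∀ f : Ω →ₘ[μ] ℝ,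
      modular Phi q (β • f) ≤ ENNReal.ofReal C + 2 * modular Phi p f := by
  obtain ⟨r, hr, hint⟩ := h
  set L := logRatio q p
  have mE : Measurable fun x => ENNReal.ofReal (Real.exp (r * L x)) :=
    (Real.measurable_exp.comp (L.measurable.const_mul r)).ennreal_ofReal
  have mE' : Measurable fun x => ENNReal.ofReal (Real.exp (L x)) *
      ENNReal.ofReal (Real.exp (r * L x)) := (measurable_ofReal_exp_logRatio q p).mul mE
  set I := ∫⁻ x, ENNReal.ofReal (Real.exp (r * L x)) ∂q.prob with hI
  have hItop : I < ∞ :=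
    (hasFiniteIntegral_iff_ofReal (Filter.Eventually.of_forall fun x => (Real.exp_pos _).le)).1
      hint.2
  refine ⟨r / (1 + r), by positivity, I.toReal + 2, by positivity, fun f => ?_⟩
  have mf : Measurable fun x => ENNReal.ofReal (Phi (f x)) :=
    (measurable_Phi.comp f.measurable).ennreal_ofReal
  have key : ∀ t y : ℝ, Real.exp t * Phi (r / (1 + r) * y)
      ≤ Real.exp t * Real.exp (r * t) + (2 + 2 * Phi y) := by
    intro t y
    have hβ : |r / (1 + r) * y| = r / (1 + r) * |y| := by
      rw [abs_mul, abs_of_pos (by positivity : 0 < r / (1 + r))]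
    calc Real.exp t * Phi (r / (1 + r) * y)
        ≤ Real.exp t * Real.exp (r / (1 + r) * |y|) := by
          gcongr; rw [← hβ]; exact Phi_le_exp_abs _
      _ = Real.exp (t + r / (1 + r) * |y|) := (Real.exp_add _ _).symm
      _ ≤ Real.exp (t + r * t) + Real.exp |y| := by
          have e : t + r / (1 + r) * |y| = 1 / (1 + r) * (t + r * t) + r / (1 + r) * |y| := by
            field_simp
          have e1 : 1 / (1 + r) + r / (1 + r) = 1 := by field_simp
          have h1 := convexOn_exp.2 (mem_univ (t + r * t)) (mem_univ |y|)
            (by positivity : 0 ≤ 1 / (1 + r)) (by positivity : 0 ≤ r / (1 + r)) e1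
          rw [e]
          refine h1.trans (add_le_add ?_ ?_)
          · exact mul_le_of_le_one_left (Real.exp_pos _).le
              (by have : 0 ≤ r / (1 + r) := by positivity
                  linarith)
          · exact mul_le_of_le_one_left (Real.exp_pos _).le
              (by have : 0 ≤ 1 / (1 + r) := by positivity
                  linarith)
      _ ≤ _ := by rw [Real.exp_add]; gcongr; exact exp_abs_le y
  calc modular Phi q ((r / (1 + r)) • f)
      = ∫⁻ x, ENNReal.ofReal (Phi (r / (1 + r) * f x)) ∂q.prob := by
        refine lintegral_congr_ae ?_
        filter_upwards [(prob_ac q).ae_le (AEEqFun.coeFn_smul (r / (1 + r)) f)] with x hx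
        rw [hx, Pi.smul_apply, smul_eq_mul]
    _ = ∫⁻ x, ENNReal.ofReal (Real.exp (L x)) *
          ENNReal.ofReal (Phi (r / (1 + r) * f x)) ∂p.prob :=
        lintegral_prob_eq q p (measurable_Phi.comp (f.measurable.const_mul _)).ennreal_ofReal
    _ ≤ ∫⁻ x, (ENNReal.ofReal (Real.exp (L x)) * ENNReal.ofReal (Real.exp (r * L x)) +
          (2 + 2 * ENNReal.ofReal (Phi (f x)))) ∂p.prob := by
        refine lintegral_mono fun x => ?_
        dsimp only
        have h2 : (2 : ℝ≥0∞) = ENNReal.ofReal 2 := by simp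
        rw [h2, ← ENNReal.ofReal_mul (Real.exp_pos _).le, ← ENNReal.ofReal_mul (Real.exp_pos _).le,
          ← ENNReal.ofReal_mul zero_le_two,
          ← ENNReal.ofReal_add zero_le_two (mul_nonneg zero_le_two (Phi_nonneg _)),
          ← ENNReal.ofReal_add (by positivity)
            (add_nonneg zero_le_two (mul_nonneg zero_le_two (Phi_nonneg _)))]
        exact ENNReal.ofReal_le_ofReal (key _ _)
    _ = I + (2 + 2 * modular Phi p f) := by
        rw [lintegral_add_left mE', ← lintegral_prob_eq q p mE, ← hI,
          lintegral_add_left measurable_const, lintegral_const, measure_univ, mul_one,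
          lintegral_const_mul _ mf, modular]
    _ = _ := by
        rw [ENNReal.ofReal_add ENNReal.toReal_nonneg zero_le_two, ENNReal.ofReal_toReal hItop.ne,
          add_assoc]
        simp

theorem LPhi_le_of_finiteMoment {p q : PosDensity μ} (h : FiniteMoment p q) :
    LPhi p ≤ LPhi q := by
  obtain ⟨β, hβ, C, -, hC⟩ := modular_le_of_finiteMoment h
  rintro f ⟨α, hα, hf⟩
  refine ⟨β * α, mul_pos hβ hα, ?_⟩
  rw [mul_smul]
  exact (hC _).trans_lt (ENNReal.add_lt_top.2
    ⟨ENNReal.ofReal_lt_top, ENNReal.mul_lt_top (by simp) hf⟩)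

/-- Under the hypothesis `FiniteMoment p q` the Luxemburg norm of `q` is bounded on the unit ball
of `L^Φ(p)`. -/
theorem norm_le_of_finiteMoment {p q : PosDensity μ} (h : FiniteMoment p q) :
    ∃ C : ℝ, ∀ (v : LPhiSpace p) (w : LPhiSpace q), incl q w = incl p v → v ∈ unitBall p →
      ‖w‖ ≤ C := by
  obtain ⟨β, hβ, C, hC0, hC⟩ := modular_le_of_finiteMoment h
  -- convexity turns the bound `C + 2` of the modular into the bound `1`
  set r := (C + 2 + 1)⁻¹ with hr
  have hr0 : 0 < r := by positivity
  have hr1 : r ≤ 1 := inv_le_one_of_one_le₀ (by linarith)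
  refine ⟨(r * β)⁻¹, fun v w hvw hv => ?_⟩
  have h1 : modular Phi q (β • incl q w) ≤ ENNReal.ofReal (C + 2) := by
    rw [hvw, ENNReal.ofReal_add hC0 zero_le_two]
    refine (hC _).trans ?_
    gcongr
    calc 2 * modular Phi p (incl p v) ≤ 2 * 1 := by gcongr; exact hv
      _ = ENNReal.ofReal 2 := by simp
  have h2 : (r * β) • w ∈ unitBall q := by
    change modular Phi q (incl q ((r * β) • w)) ≤ 1
    have h := modular_convex (p := q) (f := β • incl q w) (g := 0) hr0.le (sub_nonneg.2 hr1)
      (add_sub_cancel r 1)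
    rw [smul_zero, add_zero, modular_zero, mul_zero, add_zero, smul_smul] at h
    rw [map_smul]
    refine h.trans ((mul_le_mul_right h1 _).trans ?_)
    rw [← ENNReal.ofReal_mul hr0.le, ← ENNReal.ofReal_one]
    refine ENNReal.ofReal_le_ofReal ?_
    rw [hr, inv_mul_le_iff₀ (by positivity)]
    linarith
  have h3 : ‖(r * β) • w‖ ≤ 1 := gauge_le_one_of_mem h2
  have hpos : 0 < r * β := mul_pos hr0 hβ
  rw [norm_smul, Real.norm_eq_abs, abs_of_pos hpos] at h3
  rwa [← mul_one (r * β)⁻¹, le_inv_mul_iff₀ hpos]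

/-! ### Continuity of the expectation and of the exponential transport -/

theorem norm_map_le_of_unitBall {F : Type*} [SeminormedAddCommGroup F] [NormedSpace ℝ F]
    {p : PosDensity μ} (L : LPhiSpace p →ₗ[ℝ] F) {C : ℝ}
    (h : ∀ v ∈ unitBall p, ‖L v‖ ≤ C) (v : LPhiSpace p) : ‖L v‖ ≤ C * ‖v‖ := by
  have hC : 0 ≤ C := by
    refine (norm_nonneg _).trans (h 0 ?_)
    change modular Phi p (incl p 0) ≤ 1
    rw [map_zero, modular_zero]
    exact zero_le_one
  have key : ∀ r, ‖v‖ < r → ‖L v‖ ≤ C * r := by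
    intro r hr
    obtain ⟨b, hb, hbr, w, hw, hwv⟩ := exists_lt_of_gauge_lt (unitBall_absorbent p) hr
    have e : v = b • w := hwv.symm
    rw [e, map_smul, norm_smul, Real.norm_eq_abs, abs_of_pos hb, mul_comm]
    exact mul_le_mul (h w hw) hbr.le hb.le hC
  refine le_of_forall_pos_le_add fun ε hε => ?_
  refine (key (‖v‖ + ε / (C + 1)) (by have : 0 < ε / (C + 1) := by positivity
                                      linarith)).trans ?_
  rw [mul_add]
  gcongr
  rw [mul_div_assoc', div_le_iff₀ (by positivity)]
  nlinarith

/-- The expectation as a linear functional on `L^Φ(p)`. -/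
def expectLin (p : PosDensity μ) : LPhiSpace p →ₗ[ℝ] ℝ where
  toFun v := expect p (incl p v)
  map_add' v w := by rw [map_add, expect_add (incl_mem v) (incl_mem w)]
  map_smul' c v := by rw [map_smul, expect_smul]; rfl

theorem norm_expectLin_le {p : PosDensity μ} (v : LPhiSpace p) : ‖expectLin p v‖ ≤ 2 * ‖v‖ := by
  refine norm_map_le_of_unitBall (expectLin p) (fun w hw => ?_) v
  change ‖∫ x, incl p w x ∂p.prob‖ ≤ 2
  have hw1 : modular Phi p (incl p w) ≤ 1 := hw
  have hP : Integrable (fun x => Phi (incl p w x)) p.prob :=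
    ⟨(measurable_Phi.comp (incl p w).measurable).aestronglyMeasurable,
      (hasFiniteIntegral_iff_ofReal (Filter.Eventually.of_forall fun x => Phi_nonneg _)).2
        (hw1.trans_lt ENNReal.one_lt_top)⟩
  have hPi : ∫ x, Phi (incl p w x) ∂p.prob ≤ 1 := by
    rw [integral_eq_lintegral_of_nonneg_ae (Filter.Eventually.of_forall fun x => Phi_nonneg _)
      hP.aestronglyMeasurable]
    exact ENNReal.toReal_le_of_le_ofReal zero_le_one (by rw [ENNReal.ofReal_one]; exact hw1)
  calc ‖∫ x, incl p w x ∂p.prob‖ ≤ ∫ x, (1 + Phi (incl p w x)) ∂p.prob :=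
        norm_integral_le_of_norm_le ((integrable_const _).add hP)
          (Filter.Eventually.of_forall fun x => abs_le_one_add_Phi _)
    _ = 1 + ∫ x, Phi (incl p w x) ∂p.prob := by
        rw [integral_add (integrable_const _) hP]; simp
    _ ≤ 2 := by linarith

theorem rv_injective {p : PosDensity μ} : Function.Injective (rv : B p → Ω →ₘ[μ] ℝ) :=
  fun _ _ h => Subtype.ext (incl_injective p h)

theorem rv_mem {p : PosDensity μ} (u : B p) : rv u ∈ LPhi p := incl_mem _

theorem expect_rv {p : PosDensity μ} (u : B p) : expect p (rv u) = 0 := u.2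

theorem rv_add {p : PosDensity μ} (u v : B p) : rv (u + v) = rv u + rv v := rfl

theorem rv_smul {p : PosDensity μ} (c : ℝ) (u : B p) : rv (c • u) = c • rv u := rfl

theorem rv_zero {p : PosDensity μ} : rv (0 : B p) = 0 := rfl

theorem rv_centre {p : PosDensity μ} {f : Ω →ₘ[μ] ℝ} (hf : f ∈ LPhi p) :
    rv (centre p f) = f - AEEqFun.const Ω (expect p f) := by
  rw [centre, dif_pos hf]
  rfl

theorem const_eq_smul_one (c : ℝ) :
    (AEEqFun.const Ω c : Ω →ₘ[μ] ℝ) = c • (AEEqFun.const Ω (1 : ℝ) : Ω →ₘ[μ] ℝ) := by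
  have h : (AEEqFun.const Ω (c • (1 : ℝ)) : Ω →ₘ[μ] ℝ) = c • AEEqFun.const Ω (1 : ℝ) := rfl
  rw [← h, smul_eq_mul, mul_one]

theorem const_add (a b : ℝ) : (AEEqFun.const Ω (a + b) : Ω →ₘ[μ] ℝ)
    = AEEqFun.const Ω a + AEEqFun.const Ω b := rfl

/-- Centring as a linear map `L^Φ(q) → B_p`, when `L^Φ(q)` is contained in `L^Φ(p)`. -/
def centreLin {q p : PosDensity μ} (h : LPhi q ≤ LPhi p) : LPhiSpace q →ₗ[ℝ] B p where
  toFun v := centre p (incl q v)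
  map_add' v w := by
    have hv := h (incl_mem v)
    have hw := h (incl_mem w)
    apply rv_injective
    rw [map_add, rv_add, rv_centre hv, rv_centre hw, rv_centre ((LPhi p).add_mem hv hw),
      expect_add hv hw, const_add]
    abel
  map_smul' c v := by
    have hv := h (incl_mem v)
    apply rv_injective
    rw [map_smul, RingHom.id_apply, rv_smul, rv_centre hv, rv_centre ((LPhi p).smul_mem c hv),
      expect_smul, const_eq_smul_one (c * _), const_eq_smul_one (expect p _), smul_sub, mul_smul]

theorem exists_norm_centreLin_le {q p : PosDensity μ} (h : FiniteMoment q p) :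
    ∃ C : ℝ, ∀ v, ‖centreLin (LPhi_le_of_finiteMoment h) v‖ ≤ C * ‖v‖ := by
  obtain ⟨C, hC⟩ := norm_le_of_finiteMoment h
  have hle := LPhi_le_of_finiteMoment h
  set e : LPhiSpace p := ⟨AEEqFun.const Ω (1 : ℝ), const_mem p 1⟩ with he
  refine ⟨(1 + 2 * ‖e‖) * C, norm_map_le_of_unitBall _ fun v hv => ?_⟩
  set w : LPhiSpace p := ⟨incl q v, hle (incl_mem v)⟩ with hw
  have hwv : incl p w = incl q v := rfl
  have h1 : ((centreLin hle v : B p) : LPhiSpace p) = w - expectLin p w • e := by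
    apply incl_injective p
    change rv (centre p (incl q v)) = _
    rw [rv_centre (hle (incl_mem v)), const_eq_smul_one, map_sub, map_smul]
    rfl
  have h2 := norm_expectLin_le w
  have h3 := hC v w hwv hv
  calc ‖centreLin hle v‖ = ‖w - expectLin p w • e‖ := by rw [← h1]; rfl
    _ ≤ ‖w‖ + ‖expectLin p w‖ * ‖e‖ := by rw [← norm_smul]; exact norm_sub_le _ _
    _ ≤ ‖w‖ + 2 * ‖w‖ * ‖e‖ := by gcongr
    _ = (1 + 2 * ‖e‖) * ‖w‖ := by ring
    _ ≤ _ := by gcongr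

/-- The exponential transport `B_q → B_p` as a continuous linear map. -/
def eTransportL {q p : PosDensity μ} (h : FiniteMoment q p) : B q →L[ℝ] B p :=
  (LinearMap.mkContinuousOfExistsBound _ (exists_norm_centreLin_le h)).comp (B q).subtypeL

theorem rv_eTransport {q p : PosDensity μ} (h : FiniteMoment q p) (w : B q) :
    rv (eTransport q p w) = rv w - AEEqFun.const Ω (expect p (rv w)) :=
  rv_centre (LPhi_le_of_finiteMoment h (rv_mem w))

theorem centre_sub_const {p : PosDensity μ} {f : Ω →ₘ[μ] ℝ} (hf : f ∈ LPhi p) (c : ℝ) :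
    centre p (f - AEEqFun.const Ω c) = centre p f := by
  have h := (LPhi p).sub_mem hf (const_mem p c)
  have e : expect p (f - AEEqFun.const Ω c) = expect p f - c := by
    rw [sub_eq_add_neg, ← neg_one_smul ℝ, expect_add hf ((LPhi p).smul_mem _ (const_mem p c)),
      expect_smul, expect_const]
    ring
  apply rv_injective
  rw [rv_centre h, rv_centre hf, e, sub_sub, ← const_add, add_sub_cancel]

theorem centre_rv {p : PosDensity μ} (u : B p) : centre p (rv u) = u := by
  apply rv_injective
  rw [rv_centre (rv_mem u), expect_rv, const_eq_smul_one, zero_smul, sub_zero]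

theorem eTransport_eTransport {q p : PosDensity μ} (h : FiniteMoment q p) (w : B q) :
    eTransport p q (eTransport q p w) = w := by
  rw [eTransport, rv_eTransport h, centre_sub_const (rv_mem w), centre_rv]

/-- The exponential transport as an isomorphism of normed spaces. -/
def eTransportEquiv {q p : PosDensity μ} (h : FiniteMoment q p) (h' : FiniteMoment p q) :
    B q ≃L[ℝ] B p :=
  ContinuousLinearEquiv.equivOfInverse (eTransportL h) (eTransportL h')
    (fun w => eTransport_eTransport h w) (fun w => eTransport_eTransport h' w)

/-- The transition map `s_p ∘ e_q`, with `u` the coordinate of `q` in the chart centred at `p`: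
the affine map `v ↦ u + (v - E_p v)`. -/
def transition {q p : PosDensity μ} (h : FiniteMoment q p) (h' : FiniteMoment p q) (u : B p) :
    B q ≃ₜ B p :=
  (eTransportEquiv h h').toHomeomorph.trans (Homeomorph.addLeft u)

theorem transition_apply {q p : PosDensity μ} (h : FiniteMoment q p) (h' : FiniteMoment p q)
    (u : B p) (v : B q) : transition h h' u v = u + eTransport q p v := rfl

/-! ### The domain of the cumulant generating functional -/

theorem K_lt_top_iff {p : PosDensity μ} {u : B p} :
    K p u < ⊤ ↔ Integrable (fun x => Real.exp (rv u x)) p.prob := by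
  rw [K, ENNReal.log_lt_top_iff, M, Integrable,
    hasFiniteIntegral_iff_ofReal (Filter.Eventually.of_forall fun x => (Real.exp_pos _).le)]
  exact (and_iff_right (Real.measurable_exp.comp (rv u).measurable).aestronglyMeasurable).symm

theorem exp_K_eq_integral {p : PosDensity μ} {u : B p} (h : K p u < ⊤) :
    Real.exp (K p u).toReal = ∫ x, Real.exp (rv u x) ∂p.prob := by
  rw [exp_K_toReal h, M, integral_eq_lintegral_of_nonneg_ae
    (Filter.Eventually.of_forall fun x => (Real.exp_pos _).le)
    (K_lt_top_iff.1 h).aestronglyMeasurable]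

theorem K_lt_top_of_mem_S {p : PosDensity μ} {u : B p} (h : u ∈ S p) : K p u < ⊤ :=
  interior_subset (s := {u | K p u < ⊤}) h

theorem isOpen_S (p : PosDensity μ) : IsOpen (S p) := isOpen_interior

/-- The open unit ball of `B_p` lies in the domain of `K_p`, since `e^u ≤ 2 + 2 Φ(u)`. -/
theorem zero_mem_S (p : PosDensity μ) : (0 : B p) ∈ S p := by
  refine mem_interior.2 ⟨Metric.ball 0 1, fun u hu => ?_, Metric.isOpen_ball,
    Metric.mem_ball_self one_pos⟩
  have hu' : gauge (unitBall p) (u : LPhiSpace p) < 1 := mem_ball_zero_iff.1 hu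
  obtain ⟨b, hb, hb1, w, hw, hwu⟩ := exists_lt_of_gauge_lt (unitBall_absorbent p) hu'
  have h1 : modular Phi p (rv u) ≤ 1 := by
    have e : rv u = b • incl p w := by
      rw [← map_smul]; exact congrArg (incl p) hwu.symm
    rw [e]
    exact (modular_smul_le (by rw [abs_of_pos hb]; exact hb1.le)).trans hw
  have hP : Integrable (fun x => Phi (rv u x)) p.prob :=
    ⟨(measurable_Phi.comp (rv u).measurable).aestronglyMeasurable,
      (hasFiniteIntegral_iff_ofReal (Filter.Eventually.of_forall fun x => Phi_nonneg _)).2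
        (h1.trans_lt ENNReal.one_lt_top)⟩
  refine K_lt_top_iff.2 (((integrable_const (2 : ℝ)).add (hP.const_mul 2)).mono'
    (Real.measurable_exp.comp (rv u).measurable).aestronglyMeasurable
    (Filter.Eventually.of_forall fun x => ?_))
  rw [Real.norm_eq_abs, Real.abs_exp]
  exact (Real.exp_le_exp.2 (le_abs_self _)).trans (exp_abs_le _)

theorem exists_one_add_smul_mem {p : PosDensity μ} {u : B p} (h : u ∈ S p) :
    ∃ r : ℝ, 0 < r ∧ K p ((1 + r) • u) < ⊤ := by
  have hc : Continuous fun r : ℝ => (1 + r) • u := by fun_prop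
  have h0 : (fun r : ℝ => (1 + r) • u) ⁻¹' S p ∈ 𝓝 (0 : ℝ) :=
    ((isOpen_S p).preimage hc).mem_nhds (by simpa using h)
  obtain ⟨ε, hε, hball⟩ := Metric.mem_nhds_iff.1 h0
  refine ⟨ε / 2, by positivity, K_lt_top_of_mem_S (hball ?_)⟩
  rw [Metric.mem_ball, Real.dist_eq, sub_zero, abs_of_pos (by positivity)]
  linarith

/-! ### Densities in the maximal exponential model -/

theorem PosDensity.ext_ae {p q : PosDensity μ} (h : ∀ᵐ x ∂μ, p.dens x = q.dens x) : p = q := by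
  have h' : p.dens = q.dens := AEEqFun.ext h
  cases p
  cases q
  cases h'
  rfl

theorem chartInv_ae {p : PosDensity μ} {u : B p} (h : K p u < ⊤) :
    ∀ᵐ x ∂μ, (chartInv p u).dens x = Real.exp (rv u x - (K p u).toReal) * p.dens x := by
  rw [chartInv, dif_pos h]
  exact gibbs_ae p u

theorem logRatio_chartInv {p : PosDensity μ} {u : B p} (h : K p u < ⊤) :
    logRatio (chartInv p u) p = rv u - AEEqFun.const Ω (K p u).toReal := by
  refine AEEqFun.ext ?_
  filter_upwards [chartInv_ae h, p.pos, exp_logRatio_ae (chartInv p u) p,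
    AEEqFun.coeFn_sub (rv u) (AEEqFun.const Ω (K p u).toReal : Ω →ₘ[μ] ℝ),
    AEEqFun.coeFn_const (μ := μ) Ω (K p u).toReal] with x h1 h2 h3 h4 h5
  rw [h1, mul_div_cancel_right₀ _ h2.ne', Real.exp_eq_exp] at h3
  rw [h3, h4, Pi.sub_apply, h5, Function.const_apply]

theorem logRatio_chartInv_ae {p : PosDensity μ} {u : B p} (h : K p u < ⊤) :
    ∀ᵐ x ∂μ, logRatio (chartInv p u) p x = rv u x - (K p u).toReal := by
  rw [logRatio_chartInv h]
  filter_upwards [AEEqFun.coeFn_sub (rv u) (AEEqFun.const Ω (K p u).toReal : Ω →ₘ[μ] ℝ),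
    AEEqFun.coeFn_const (μ := μ) Ω (K p u).toReal] with x h4 h5
  rw [h4, Pi.sub_apply, h5, Function.const_apply]

theorem chart_chartInv {p : PosDensity μ} {u : B p} (h : K p u < ⊤) :
    chart p (chartInv p u) = u := by
  rw [chart, logRatio_chartInv h, centre_sub_const (rv_mem u), centre_rv]

theorem finiteMoment_chartInv {p : PosDensity μ} {u : B p} (h : u ∈ S p) :
    FiniteMoment p (chartInv p u) := by
  obtain ⟨r, hr, hK⟩ := exists_one_add_smul_mem h
  refine ⟨r, hr, (integrable_prob_iff _ p).2 ?_⟩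
  refine ((K_lt_top_iff.1 hK).const_mul (Real.exp (-((1 + r) * (K p u).toReal)))).congr ?_
  filter_upwards [(prob_ac p).ae_le (logRatio_chartInv_ae (K_lt_top_of_mem_S h)),
    (prob_ac p).ae_le (AEEqFun.coeFn_smul (1 + r) (rv u))] with x h1 h2
  rw [h1, rv_smul, h2, Pi.smul_apply, smul_eq_mul, ← Real.exp_add, ← Real.exp_add]
  congr 1
  ring

/-- The reverse moment is finite because `u` has exponential moments of both signs. -/
theorem finiteMoment_chartInv_symm {p : PosDensity μ} {u : B p} (h : K p u < ⊤) :
    FiniteMoment (chartInv p u) p := by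
  obtain ⟨r, hr, -, hi⟩ := mem_LPhi_iff_integrable_exp.1 (rv_mem u)
  refine ⟨r, hr, (hi.const_mul (Real.exp (r * (K p u).toReal))).congr ?_⟩
  filter_upwards [(prob_ac p).ae_le (logRatio_chartInv_ae h),
    (prob_ac p).ae_le (logRatio_swap_ae (chartInv p u) p)] with x h1 h2
  rw [h2, h1, ← Real.exp_add]
  congr 1
  ring

/-! ### Change of the centre of the chart -/

theorem chart_mem_S {p q : PosDensity μ} (hq : q ∈ maxExp p) : chart p q ∈ S p := by
  obtain ⟨u, hu, rfl⟩ := hq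
  rwa [chart_chartInv (K_lt_top_of_mem_S hu)]

theorem chartInv_chart {p q : PosDensity μ} (hq : q ∈ maxExp p) : chartInv p (chart p q) = q := by
  obtain ⟨u, hu, rfl⟩ := hq
  rw [chart_chartInv (K_lt_top_of_mem_S hu)]

theorem finiteMoment_of_mem {p q : PosDensity μ} (hq : q ∈ maxExp p) : FiniteMoment p q := by
  obtain ⟨u, hu, rfl⟩ := hq
  exact finiteMoment_chartInv hu

theorem finiteMoment_of_mem_symm {p q : PosDensity μ} (hq : q ∈ maxExp p) : FiniteMoment q p := by
  obtain ⟨u, hu, rfl⟩ := hq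
  exact finiteMoment_chartInv_symm (K_lt_top_of_mem_S hu)

theorem LPhi_eq_of_mem {p q : PosDensity μ} (hq : q ∈ maxExp p) : LPhi q = LPhi p :=
  le_antisymm (LPhi_le_of_finiteMoment (finiteMoment_of_mem_symm hq))
    (LPhi_le_of_finiteMoment (finiteMoment_of_mem hq))

theorem rv_eTransport_ae {q p : PosDensity μ} (h : FiniteMoment q p) (w : B q) :
    ∀ᵐ x ∂μ, rv (eTransport q p w) x = rv w x - expect p (rv w) := by
  rw [rv_eTransport h]
  filter_upwards [AEEqFun.coeFn_sub (rv w) (AEEqFun.const Ω (expect p (rv w)) : Ω →ₘ[μ] ℝ),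
    AEEqFun.coeFn_const (μ := μ) Ω (expect p (rv w))] with x h4 h5
  rw [h4, Pi.sub_apply, h5, Function.const_apply]

theorem logRatio_ae_of_mem {p q : PosDensity μ} (hq : q ∈ maxExp p) :
    ∀ᵐ x ∂μ, logRatio q p x = rv (chart p q) x - (K p (chart p q)).toReal := by
  have h := logRatio_chartInv_ae (K_lt_top_of_mem_S (chart_mem_S hq))
  rwa [chartInv_chart hq] at h

/-- `e^v q = c e^{T v} p`, where `T` is the transition map between the charts centred at `q` and
at `p`. -/
theorem exp_mul_exp_ae {p q : PosDensity μ} (hq : q ∈ maxExp p) (v : B q) :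
    ∀ᵐ x ∂μ, Real.exp (logRatio q p x) * Real.exp (rv v x)
      = Real.exp (expect p (rv v) - (K p (chart p q)).toReal) *
        Real.exp (rv (chart p q + eTransport q p v) x) := by
  filter_upwards [logRatio_ae_of_mem hq, rv_eTransport_ae (finiteMoment_of_mem_symm hq) v,
    AEEqFun.coeFn_add (rv (chart p q)) (rv (eTransport q p v))] with x h1 h2 h3
  rw [h1, rv_add, h3, Pi.add_apply, h2, ← Real.exp_add, ← Real.exp_add]
  congr 1
  ring

theorem K_transition_lt_top_iff {p q : PosDensity μ} (hq : q ∈ maxExp p) (v : B q) :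
    K p (chart p q + eTransport q p v) < ⊤ ↔ K q v < ⊤ := by
  rw [K_lt_top_iff, K_lt_top_iff, integrable_prob_iff q p,
    integrable_congr ((prob_ac p).ae_le (exp_mul_exp_ae hq v)),
    integrable_const_mul_iff (Real.exp_pos _).ne'.isUnit]

theorem K_transition {p q : PosDensity μ} (hq : q ∈ maxExp p) {v : B q} (hv : K q v < ⊤) :
    (K q v).toReal = expect p (rv v) - (K p (chart p q)).toReal +
      (K p (chart p q + eTransport q p v)).toReal := by
  rw [← Real.exp_eq_exp, Real.exp_add, exp_K_eq_integral hv,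
    exp_K_eq_integral ((K_transition_lt_top_iff hq v).2 hv), integral_prob_eq q p,
    integral_congr_ae ((prob_ac p).ae_le (exp_mul_exp_ae hq v)), integral_const_mul]

theorem chartInv_transition {p q : PosDensity μ} (hq : q ∈ maxExp p) {v : B q} (hv : K q v < ⊤) :
    chartInv q v = chartInv p (chart p q + eTransport q p v) := by
  refine PosDensity.ext_ae ?_
  filter_upwards [chartInv_ae hv, chartInv_ae ((K_transition_lt_top_iff hq v).2 hv),
    exp_mul_exp_ae hq v, exp_logRatio_ae q p, p.pos] with x h1 h2 h3 h4 h5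
  have h6 : q.dens x = Real.exp (logRatio q p x) * p.dens x := by
    rw [h4, div_mul_cancel₀ _ h5.ne']
  calc (chartInv q v).dens x
      = Real.exp (-(K q v).toReal) * (Real.exp (logRatio q p x) * Real.exp (rv v x)) *
          p.dens x := by
        rw [h1, h6, sub_eq_neg_add, Real.exp_add]; ring
    _ = Real.exp (-(K q v).toReal + (expect p (rv v) - (K p (chart p q)).toReal)
          + rv (chart p q + eTransport q p v) x) * p.dens x := by
        rw [h3, Real.exp_add, Real.exp_add]; ring
    _ = _ := by
        rw [h2, K_transition hq hv]
        congr 2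
        ring

/-- The transition map is a homeomorphism of `B_q` onto `B_p` that matches the domains of `K_q`
and `K_p`, hence also their interiors. -/
theorem transition_preimage_S {p q : PosDensity μ} (hq : q ∈ maxExp p) :
    (fun v => chart p q + eTransport q p v) ⁻¹' S p = S q := by
  have h := (transition (finiteMoment_of_mem_symm hq) (finiteMoment_of_mem hq)
    (chart p q)).preimage_interior {u | K p u < ⊤}
  refine h.trans (congrArg interior (Set.ext fun v => ?_))
  exact K_transition_lt_top_iff hq v

theorem transition_mem_S_iff {p q : PosDensity μ} (hq : q ∈ maxExp p) {v : B q} :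
    chart p q + eTransport q p v ∈ S p ↔ v ∈ S q := by
  rw [← transition_preimage_S hq, Set.mem_preimage]

theorem maxExp_eq_of_mem {p q : PosDensity μ} (hq : q ∈ maxExp p) : maxExp q = maxExp p := by
  apply Subset.antisymm
  · rintro _ ⟨v, hv, rfl⟩
    exact ⟨_, (transition_mem_S_iff hq).2 hv,
      (chartInv_transition hq (K_lt_top_of_mem_S hv)).symm⟩
  · rintro _ ⟨u, hu, rfl⟩
    obtain ⟨v, hv⟩ := (transition (finiteMoment_of_mem_symm hq) (finiteMoment_of_mem hq)
      (chart p q)).surjective u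
    rw [transition_apply] at hv
    subst hv
    have hv := (transition_mem_S_iff hq).1 hu
    exact ⟨v, hv, chartInv_transition hq (K_lt_top_of_mem_S hv)⟩

/-! ### Derivatives in the charts -/

theorem rep_eqOn {p q : PosDensity μ} (hq : q ∈ maxExp p) (E : PosDensity μ → ℝ) :
    EqOn (rep E q) (fun v => rep E p (chart p q + eTransport q p v)) (S q) := fun _ hv =>
  congrArg E (chartInv_transition hq (K_lt_top_of_mem_S hv))

theorem isC1On_of_mem {p q : PosDensity μ} (hq : q ∈ maxExp p) {E : PosDensity μ → ℝ}
    (hE : IsC1On E p) : IsC1On E q := by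
  have hT : ContDiff ℝ 1 fun v : B q => chart p q + eTransport q p v :=
    contDiff_const.add (eTransportL (finiteMoment_of_mem_symm hq)).contDiff
  exact (hE.comp hT.contDiffOn fun v hv => (transition_mem_S_iff hq).2 hv).congr (rep_eqOn hq E)

theorem differentiableAt_rep {p : PosDensity μ} {E : PosDensity μ → ℝ} (hE : IsC1On E p)
    {u : B p} (hu : u ∈ S p) : DifferentiableAt ℝ (rep E p) u :=
  (hE.contDiffAt ((isOpen_S p).mem_nhds hu)).differentiableAt one_ne_zero

/-- The chain rule for the affine transition map: the differential at `q` in the chart centred at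
`p` is the differential in the chart centred at `q`, up to the exponential transport. -/
theorem fderiv_rep_eTransport {p q : PosDensity μ} (hq : q ∈ maxExp p) {E : PosDensity μ → ℝ}
    (hE : IsC1On E p) (w : B q) :
    fderiv ℝ (rep E p) (chart p q) (eTransport q p w) = fderiv ℝ (rep E q) 0 w := by
  have hA := (eTransportL (finiteMoment_of_mem_symm hq)).hasFDerivAt (x := (0 : B q))
  have hT := hA.const_add (chart p q)
  have h0 : chart p q + eTransportL (finiteMoment_of_mem_symm hq) 0 = chart p q := by
    rw [map_zero, add_zero]
  have hd := (differentiableAt_rep hE (chart_mem_S hq)).hasFDerivAt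
  rw [← h0] at hd
  have heq : rep E q =ᶠ[𝓝 0]
      rep E p ∘ fun v => chart p q + eTransportL (finiteMoment_of_mem_symm hq) v :=
    Filter.eventuallyEq_of_mem ((isOpen_S q).mem_nhds (zero_mem_S q)) (rep_eqOn hq E)
  have hc := (hd.comp (0 : B q) hT).congr_of_eventuallyEq heq
  rw [hc.fderiv, h0]
  rfl

/-! ### The mixture transport and the covariant gradient -/

theorem mTransport_ae (p q : PosDensity μ) (g : Ω →ₘ[μ] ℝ) :
    ∀ᵐ x ∂μ, mTransport p q g x = Real.exp (logRatio p q x) * g x := by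
  filter_upwards [AEEqFun.coeFn_mk (μ := μ) (fun x => p.dens x / q.dens x * g x)
    ((p.dens.measurable.div q.dens.measurable).mul g.measurable).aestronglyMeasurable,
    exp_logRatio_ae p q] with x h1 h2
  rw [mTransport, h1, h2]

theorem mTransport_mul_ae (p q : PosDensity μ) (g f : Ω →ₘ[μ] ℝ) :
    ∀ᵐ x ∂μ, (mTransport p q g * f) x = Real.exp (logRatio p q x) * (f x * g x) := by
  filter_upwards [mTransport_ae p q g, AEEqFun.coeFn_mul (mTransport p q g) f] with x h1 h2
  rw [h2, Pi.mul_apply, h1]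
  ring

theorem integrable_mTransport_mul {p q : PosDensity μ} {g f : Ω →ₘ[μ] ℝ} (hf : f ∈ LPhi p)
    (hg : MemOrlicz PhiStar p g) : Integrable (fun x => (mTransport p q g * f) x) q.prob := by
  rw [integrable_congr ((prob_ac q).ae_le (mTransport_mul_ae p q g f)), ← integrable_prob_iff p q]
  exact integrable_mul_of_mem hf hg

theorem expect_mTransport (p q : PosDensity μ) (g : Ω →ₘ[μ] ℝ) :
    expect q (mTransport p q g) = expect p g := by
  rw [expect, integral_congr_ae ((prob_ac q).ae_le (mTransport_ae p q g)),
    ← integral_prob_eq p q]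
  rfl

/-- The mixture transport is the transpose of the exponential transport. -/
theorem expect_mTransport_mul {p q : PosDensity μ} (h : FiniteMoment q p) {g : Ω →ₘ[μ] ℝ}
    (hg : g ∈ preB p) (w : B q) :
    expect q (mTransport p q g * rv w) = expect p (g * rv (eTransport q p w)) := by
  have hi := integrable_mul_of_mem (LPhi_le_of_finiteMoment h (rv_mem w)) hg.1
  have hg0 : ∫ x, g x ∂p.prob = 0 := hg.2
  have h1 : expect p (g * rv (eTransport q p w))
      = ∫ x, (rv w x * g x - expect p (rv w) * g x) ∂p.prob := by
    refine integral_congr_ae ?_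
    filter_upwards [(prob_ac p).ae_le (AEEqFun.coeFn_mul g (rv (eTransport q p w))),
      (prob_ac p).ae_le (rv_eTransport_ae h w)] with x h2 h3
    rw [h2, Pi.mul_apply, h3]
    ring
  rw [h1, integral_sub hi ((integrable_of_memOrlicz_PhiStar hg.1).const_mul _),
    integral_const_mul, hg0, mul_zero, sub_zero, expect,
    integral_congr_ae ((prob_ac q).ae_le (mTransport_mul_ae p q g (rv w))),
    ← integral_prob_eq p q]

/-- The mixture transport maps `L^{Φ_*}(p)` to `L^{Φ_*}(q)`: the entropy-like growth of `Φ_*`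
leaves the term `E_p [|g| |log (p / q)|]`, a pairing of `L^{Φ_*}(p)` with `L^Φ(p)`. -/
theorem memOrlicz_mTransport {p q : PosDensity μ} {g : Ω →ₘ[μ] ℝ} (h : logRatio p q ∈ LPhi p)
    (hg : MemOrlicz PhiStar p g) : MemOrlicz PhiStar q (mTransport p q g) := by
  have h1 := integrable_mul_of_mem h hg
  have h2 := integrable_of_memOrlicz_PhiStar hg
  obtain ⟨b, hb, h3⟩ := memOrlicz_PhiStar_iff.1 hg
  have h4 : Integrable (fun x => b * |logRatio p q x * g x| +
      (b * |g x| + PhiStar (b * g x))) p.prob :=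
    (h1.abs.const_mul b).add ((h2.abs.const_mul b).add h3)
  refine memOrlicz_PhiStar_iff.2 ⟨b, hb, ?_⟩
  refine ((integrable_prob_iff p q).1 h4).mono'
    (measurable_PhiStar.comp ((mTransport p q g).measurable.const_mul b)).aestronglyMeasurable ?_
  filter_upwards [(prob_ac q).ae_le (mTransport_ae p q g)] with x hx
  rw [Real.norm_eq_abs, abs_of_nonneg (PhiStar_nonneg _), hx]
  have h5 := PhiStar_exp_mul_le (logRatio p q x) (b * g x)
  rw [abs_mul b, abs_of_pos hb] at h5
  calc PhiStar (b * (Real.exp (logRatio p q x) * g x))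
      = PhiStar (Real.exp (logRatio p q x) * (b * g x)) := by congr 1; ring
    _ ≤ _ := h5
    _ = _ := by rw [abs_mul]; ring

theorem logRatio_mem_LPhi {p q : PosDensity μ} (hq : q ∈ maxExp p) : logRatio p q ∈ LPhi p := by
  set u := chart p q
  have hu : K p u < ⊤ := K_lt_top_of_mem_S (chart_mem_S hq)
  have e : logRatio p q = AEEqFun.const Ω (K p u).toReal - rv u := by
    refine AEEqFun.ext ?_
    filter_upwards [logRatio_swap_ae q p, logRatio_ae_of_mem hq,
      AEEqFun.coeFn_sub (AEEqFun.const Ω (K p u).toReal : Ω →ₘ[μ] ℝ) (rv u),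
      AEEqFun.coeFn_const (μ := μ) Ω (K p u).toReal] with x h1 h2 h3 h4
    rw [h1, h2, h3, Pi.sub_apply, h4, Function.const_apply, neg_sub]
  rw [e]
  exact (LPhi p).sub_mem (const_mem p _) (rv_mem u)

theorem mTransport_mem_preB {p q : PosDensity μ} (hq : q ∈ maxExp p) {g : Ω →ₘ[μ] ℝ}
    (hg : g ∈ preB p) : mTransport p q g ∈ preB q :=
  ⟨memOrlicz_mTransport (logRatio_mem_LPhi hq) hg.1, (expect_mTransport p q g).trans hg.2⟩

/-- The pairing of `L^{Φ_*}_0(q)` with `B_q` separates the points of `L^{Φ_*}_0(q)`: the difference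
of two elements is tested against its centred sign. -/
theorem eq_of_expect_mul_eq {q : PosDensity μ} {h k : Ω →ₘ[μ] ℝ} (hh : h ∈ preB q)
    (hk : k ∈ preB q) (heq : ∀ v : B q, expect q (h * rv v) = expect q (k * rv v)) : h = k := by
  have hsm : Measurable fun x => if k x ≤ h x then (1 : ℝ) else -1 :=
    Measurable.ite (measurableSet_le k.measurable h.measurable) measurable_const measurable_const
  set s : Ω →ₘ[μ] ℝ := AEEqFun.mk (fun x => if k x ≤ h x then (1 : ℝ) else -1)
    hsm.aestronglyMeasurable
  have hs_ae : ∀ᵐ x ∂q.prob, s x = if k x ≤ h x then (1 : ℝ) else -1 :=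
    (prob_ac q).ae_le (AEEqFun.coeFn_mk _ _)
  have hs_mem : s ∈ LPhi q := by
    refine mem_LPhi_iff_integrable.2 ⟨1, one_pos, ?_⟩
    refine (integrable_const (Phi 1)).mono'
      (measurable_Phi.comp (s.measurable.const_mul 1)).aestronglyMeasurable ?_
    filter_upwards [hs_ae] with x hx
    rw [Real.norm_eq_abs, abs_of_nonneg (Phi_nonneg _), one_mul, hx]
    refine Phi_le_of_abs_le ?_
    split_ifs <;> simp
  set c := expect q s
  have hv_ae : ∀ᵐ x ∂q.prob, rv (centre q s) x = s x - c := by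
    rw [rv_centre hs_mem]
    filter_upwards [(prob_ac q).ae_le (AEEqFun.coeFn_sub s (AEEqFun.const Ω c : Ω →ₘ[μ] ℝ)),
      (prob_ac q).ae_le (AEEqFun.coeFn_const (μ := μ) Ω c)] with x h4 h5
    rw [h4, Pi.sub_apply, h5, Function.const_apply]
  have hsplit : ∀ f : Ω →ₘ[μ] ℝ, f ∈ preB q →
      expect q (f * rv (centre q s)) = ∫ x, s x * f x ∂q.prob := by
    intro f hf
    have hf0 : ∫ x, f x ∂q.prob = 0 := hf.2
    have e : expect q (f * rv (centre q s)) = ∫ x, (s x * f x - c * f x) ∂q.prob := by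
      refine integral_congr_ae ?_
      filter_upwards [(prob_ac q).ae_le (AEEqFun.coeFn_mul f (rv (centre q s))), hv_ae]
        with x h1 h2
      rw [h1, Pi.mul_apply, h2]
      ring
    rw [e, integral_sub (integrable_mul_of_mem hs_mem hf.1)
      ((integrable_of_memOrlicz_PhiStar hf.1).const_mul _), integral_const_mul, hf0, mul_zero,
      sub_zero]
  have h1 := heq (centre q s)
  rw [hsplit h hh, hsplit k hk, ← sub_eq_zero,
    ← integral_sub (integrable_mul_of_mem hs_mem hh.1) (integrable_mul_of_mem hs_mem hk.1)] at h1
  have h2 : ∫ x, |h x - k x| ∂q.prob = 0 := by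
    rw [← h1]
    refine integral_congr_ae ?_
    filter_upwards [hs_ae] with x hx
    rw [hx, ← mul_sub]
    split_ifs with hle
    · rw [abs_of_nonneg (sub_nonneg.2 hle), one_mul]
    · rw [abs_of_neg (sub_neg.2 (not_le.1 hle)), neg_one_mul]
  have hd : Integrable (fun x => |h x - k x|) q.prob :=
    ((integrable_of_memOrlicz_PhiStar hh.1).sub (integrable_of_memOrlicz_PhiStar hk.1)).abs
  rw [integral_eq_zero_iff_of_nonneg (fun x => abs_nonneg _) hd] at h2
  refine AEEqFun.ext ?_
  filter_upwards [(ac_prob q).ae_le h2] with x hx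
  exact sub_eq_zero.1 (abs_eq_zero.1 hx)

/-- A covariant gradient is determined by `dE_q(0)`, as every vector of `B_q` is the value at `q`
of some vector field. -/
theorem IsCovGradient.unique {E : PosDensity μ → ℝ} {q : PosDensity μ} {h k : Ω →ₘ[μ] ℝ}
    (hh : IsCovGradient E q h) (hk : IsCovGradient E q k) : h = k := by
  classical
  refine eq_of_expect_mul_eq hh.1 hk.1 fun v => ?_
  have h1 := (hh.2 (Function.update (fun _ => 0) q v)).symm.trans
    (hk.2 (Function.update (fun _ => 0) q v))
  rwa [Function.update_self] at h1

end ExpModel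

end

theorem mainTheorem4 {Ω : Type*} [MeasurableSpace Ω] (μ : Measure Ω) [SigmaFinite μ]
    (p₀ : PosDensity μ) (E : PosDensity μ → ℝ) (hE : IsC1On E p₀) :
    -- the charts centred at points of the model, their inverses and the transports are genuine
    (∀ p ∈ maxExp p₀, maxExp p = maxExp p₀ ∧ MapsTo (chart p) (maxExp p₀) (S p) ∧
      InvOn (chartInv p) (chart p) (maxExp p₀) (S p) ∧ ContDiffOn ℝ 1 (rep E p) (S p)) ∧
    (∀ p ∈ maxExp p₀, ∀ q ∈ maxExp p₀, LPhi q = LPhi p) ∧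
    -- the functional on the fibre at `q` does not depend on the centre `p`
    (∀ q ∈ maxExp p₀, ∃ ℓ : B q →L[ℝ] ℝ, ∀ p ∈ maxExp p₀,
      DifferentiableAt ℝ (rep E p) (chart p q) ∧
      ∀ w : B q, fderiv ℝ (rep E p) (chart p q) (eTransport q p w) = ℓ w) ∧
    -- the covariant derivative computed in any chart
    (∀ G : (q : PosDensity μ) → B q, ∀ q ∈ maxExp p₀, DifferentiableAt ℝ (rep E q) 0 ∧
      ∀ p ∈ maxExp p₀,
        covDeriv E G q = fderiv ℝ (rep E p) (chart p q) (eTransport q p (G q))) ∧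
    -- the covariant gradient
    (∀ p ∈ maxExp p₀, ∀ q ∈ maxExp p₀, ∀ g ∈ preB p,
      (∀ v : B p, fderiv ℝ (rep E p) (chart p q) v = expect p (g * rv v)) →
      (∀ G : (r : PosDensity μ) → B r,
        Integrable (fun x => (mTransport p q g * rv (G q)) x) q.prob ∧
        covDeriv E G q = expect q (mTransport p q g * rv (G q))) ∧
      IsCovGradient E q (mTransport p q g) ∧
      ∀ h, IsCovGradient E q h → h = mTransport p q g) := by
  have hmem : ∀ {p q}, p ∈ maxExp p₀ → q ∈ maxExp p₀ → q ∈ maxExp p := fun hp hq => by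
    rwa [maxExp_eq_of_mem hp]
  have hC1 : ∀ {p}, p ∈ maxExp p₀ → IsC1On E p := fun hp => isC1On_of_mem hp hE
  refine ⟨fun p hp => ⟨maxExp_eq_of_mem hp, fun q hq => chart_mem_S (hmem hp hq),
    ⟨fun q hq => chartInv_chart (hmem hp hq), fun u hu => chart_chartInv (K_lt_top_of_mem_S hu)⟩,
    hC1 hp⟩, fun p hp q hq => LPhi_eq_of_mem (hmem hp hq), fun q hq => ⟨fderiv ℝ (rep E q) 0,
    fun p hp => ⟨differentiableAt_rep (hC1 hp) (chart_mem_S (hmem hp hq)),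
      fderiv_rep_eTransport (hmem hp hq) (hC1 hp)⟩⟩,
    fun G q hq => ⟨differentiableAt_rep (hC1 hq) (zero_mem_S q), fun p hp =>
      (fderiv_rep_eTransport (hmem hp hq) (hC1 hp) (G q)).symm⟩, ?_⟩
  intro p hp q hq g hg hgrad
  have hpq := hmem hp hq
  have hcov : ∀ G : (r : PosDensity μ) → B r,
      covDeriv E G q = expect q (mTransport p q g * rv (G q)) := fun G => by
    rw [covDeriv, ← fderiv_rep_eTransport hpq (hC1 hp), hgrad,
      expect_mTransport_mul (finiteMoment_of_mem_symm hpq) hg]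
  have hG : IsCovGradient E q (mTransport p q g) := ⟨mTransport_mem_preB hpq hg, hcov⟩
  refine ⟨fun G => ⟨integrable_mTransport_mul ?_ hg.1, hcov G⟩, hG, fun h hh => hh.unique hG⟩
  rw [← LPhi_eq_of_mem hpq]
  exact rv_mem (G q)
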